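/- **Setting.** Let $n\ge 2$ and $R_0>0$. Let $\varphi:\mathbb R^n\to\mathbb R$ be smooth, radial, supported in $\{3/4\le|\xi|\le 8/3\}$, with $\sum_{j\in\mathbb Z}\varphi(2^{-j}\xi)=1$ for all $\xi\ne0$. Let $\mathcal Z(\mathbb R^n)$ be the space of Schwartz functions $\psi$ with $\partial^\alpha\hat\psi(0)=0$ for all multi-indices $\alpha$, let $\mathcal Z'(\mathbb R^n)$ be its dual, and put $\dot\Delta_j u=\varphi(2^{-j}D)u$ (with $D=-i\nabla$) for $u\in\mathcal Z'$. For $s,\sigma\in\mathbb R$ set $$\|u\|_{\dot B^{s}_{2,1}}=\sum_{k\in\mathbb Z}2^{ks}\|\dot\Delta_k u\|_{L^2},\qquad \|u\|_{\mathcal B^{s,\sigma}}=\sum_{2^k\le R_0}2^{ks}\|\dot\Delta_k u\|_{L^2}+\sum_{2^k>R_0}2^{k\sigma}\|\dot\Delta_k u\|_{L^2},$$ and for $0<T\le\infty$, $1\le q\le\infty$ and (weakly measurable) $u:(0,T)\to\mathcal Z'$ define $\|u\|_{\tilde L^q_T\dot B^s_{2,1}}$ and $\|u\|_{\tilde L^q_T\mathcal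 B^{s,\sigma}}$ by replacing $\|\dot\Delta_k u\|_{L^2}$ with $\|\dot\Delta_k u\|_{L^q(0,T;L^2)}$. For $f,g\in\mathcal Z'$, the product $fg\in\mathcal Z'$ is the class of the pointwise product $FG$ of the functions $F=\sum_j\dot\Delta_jf$, $G=\sum_j\dot\Delta_jg$ (series converging in $\mathcal S'$). **Proposition 5.2.** There is a constant $C$, depending only on $n$, $R_0$ and $\varphi$, such that: 1. For all $f\in\mathcal B^{n/2,\,n/2-1}$ and $g\in\mathcal B^{n/2-1,\,n/2}$ (that is, with finite norms), the product $fg$ is well defined and $$\|fg\|_{\dot B^{n/2-1}_{2,1}}\le C\,\|f\|_{\mathcal B^{n/2,\,n/2-1}}\,\|g\|_{\mathcal B^{n/2-1,\,n/2}}.$$ 2. For all $0<T\le\infty$ and $1\le r,r_1,r_2\le\infty$ with $\frac1r=\frac1{r_1}+\frac1{r_2}$, and all $f\in\tilde L^{r_1}_T\mathcal B^{n/2,\,n/2-1}$, $g\in\tilde L^{r_2}_T\mathcal B^{n/2-1,\,n/2}$, the product $f(t)g(t)$ is well defined for almost every $t\in(0,T)$, is weakly measurable in $t$, and $$\|fg\|_{\tilde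 L^r_T\dot B^{n/2-1}_{2,1}}\le C\,\|f\|_{\tilde L^{r_1}_T\mathcal B^{n/2,\,n/2-1}}\,\|g\|_{\tilde L^{r_2}_T\mathcal B^{n/2-1,\,n/2}}.$$ -/

import Mathlib

open MeasureTheory
open scoped SchwartzMap FourierTransform ENNReal NNReal

noncomputable section

namespace HybridBesov

/-- The Euclidean space `ℝⁿ`. -/
abbrev E (n : ℕ) := EuclideanSpace ℝ (Fin n)

/-- The space `𝒵(ℝⁿ)` of Schwartz functions whose Fourier transform vanishes at the origin
together with all its derivatives (with the topology induced by the Schwartz space). -/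
def Z (n : ℕ) : Submodule ℂ 𝓢(E n, ℂ) where
  carrier := {f | ∀ k : ℕ, iteratedFDeriv ℝ k (𝓕 f : 𝓢(E n, ℂ)) 0 = 0}
  zero_mem' := by
    intro k
    rw [← FourierTransform.fourierCLM_apply (R := ℂ) (0 : 𝓢(E n, ℂ)), map_zero]
    exact congrFun (iteratedFDeriv_fun_zero (𝕜 := ℝ) (E := E n) (F := ℂ) (n := k)) 0
  add_mem' := by
    intro f g hf hg k
    have h : ⇑(𝓕 (f + g) : 𝓢(E n, ℂ)) = ⇑(𝓕 f : 𝓢(E n, ℂ)) + ⇑(𝓕 g : 𝓢(E n, ℂ)) := by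
      rw [FourierTransform.fourier_add]
      rfl
    rw [h, iteratedFDeriv_add_apply ((𝓕 f : 𝓢(E n, ℂ)).smooth k).contDiffAt
        ((𝓕 g : 𝓢(E n, ℂ)).smooth k).contDiffAt, hf k, hg k, add_zero]
  smul_mem' := by
    intro c f hf k
    have h : ⇑(𝓕 (c • f) : 𝓢(E n, ℂ)) = c • ⇑(𝓕 f : 𝓢(E n, ℂ)) := by
      rw [FourierTransform.fourier_smul]
      rfl
    rw [h, iteratedFDeriv_const_smul_apply ((𝓕 f : 𝓢(E n, ℂ)).smooth k).contDiffAt, hf k, smul_zero]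

/-- The dual space `𝒵'(ℝⁿ)`. -/
abbrev ZDual (n : ℕ) := Z n →L[ℂ] ℂ

/-- A function `φ` generating a homogeneous Littlewood-Paley decomposition: smooth, radial,
supported in the annulus `3/4 ≤ |ξ| ≤ 8/3`, with `∑_{j ∈ ℤ} φ(2^{-j} ξ) = 1` for `ξ ≠ 0`.
(The low-frequency function is then `χ = ∑_{j < 0} φ(2^{-j} ·)`, extended by `χ(0) = 1`.) -/
structure LittlewoodPaley (n : ℕ) where
  φ : E n → ℝ
  smooth : ContDiff ℝ (⊤ : ℕ∞) φ
  radial : ∀ ξ η : E n, ‖ξ‖ = ‖η‖ → φ ξ = φ η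
  annulus : ∀ ξ : E n, φ ξ ≠ 0 → 3 / 4 ≤ ‖ξ‖ ∧ ‖ξ‖ ≤ 8 / 3
  partition : ∀ ξ : E n, ξ ≠ 0 → HasSum (fun j : ℤ => φ (((2 : ℝ) ^ (-j)) • ξ)) 1

namespace LittlewoodPaley

variable {n : ℕ} (P : LittlewoodPaley n)

/-- The symbol of `φ(2^{-j} D)`, `D = -i∇`, with respect to Mathlib's Fourier transform
`∫ e^{-2πi x·ξ} f(x) dx`, for which `D` has the symbol `2π ξ`. -/
def symbol (j : ℤ) (ξ : E n) : ℂ := (P.φ (((2 : ℝ) ^ (-j) * (2 * Real.pi)) • ξ) : ℂ)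

theorem symbol_hasTemperateGrowth (j : ℤ) : (P.symbol j).HasTemperateGrowth := by
  have hc : (2 : ℝ) ^ (-j) * (2 * Real.pi) ≠ 0 := by positivity
  have hφ : HasCompactSupport P.φ := by
    refine HasCompactSupport.intro (isCompact_closedBall (0 : E n) (8 / 3)) ?_
    intro x hx
    by_contra h
    exact hx (by simpa using (P.annulus x h).2)
  refine HasCompactSupport.hasTemperateGrowth (f := P.symbol j) ?_ ?_
  · have h := (hφ.comp_smul hc).comp_left (g := (fun x : ℝ => (x : ℂ))) (by simp)
    exact h
  · exact Complex.ofRealCLM.contDiff.comp (P.smooth.comp (contDiff_const_smul _))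

/-- The symbol vanishes near the origin. -/
theorem symbol_eventually_eq_zero (j : ℤ) : ∀ᶠ ξ in nhds (0 : E n), P.symbol j ξ = 0 := by
  have hcont : Continuous fun ξ : E n => ‖((2 : ℝ) ^ (-j) * (2 * Real.pi)) • ξ‖ := by fun_prop
  have := hcont.continuousAt.eventually_lt (x₀ := (0 : E n))
    (continuousAt_const (y := (3 / 4 : ℝ))) (by norm_num)
  filter_upwards [this] with ξ hξ
  by_contra h
  have h' : P.φ (((2 : ℝ) ^ (-j) * (2 * Real.pi)) • ξ) ≠ 0 := by
    intro h0
    exact h (by rw [symbol, h0, Complex.ofReal_zero])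
  exact absurd (P.annulus _ h').1 (not_le.mpr hξ)

theorem fourierMultiplier_mem (j : ℤ) (ψ : 𝓢(E n, ℂ)) :
    SchwartzMap.fourierMultiplierCLM ℂ (P.symbol j) ψ ∈ Z n := by
  intro k
  rw [SchwartzMap.fourierMultiplierCLM_apply, FourierTransform.fourier_fourierInv_eq]
  have h : ⇑(SchwartzMap.smulLeftCLM ℂ (P.symbol j) (𝓕 ψ)) =ᶠ[nhds (0 : E n)]
      (fun _ => (0 : ℂ)) := by
    filter_upwards [P.symbol_eventually_eq_zero j] with ξ hξ
    rw [SchwartzMap.smulLeftCLM_apply_apply (P.symbol_hasTemperateGrowth j), hξ, zero_smul]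
  have h2 := (h.iteratedFDeriv (𝕜 := ℝ) k).eq_of_nhds
  rw [h2]
  exact congrFun (iteratedFDeriv_fun_zero (𝕜 := ℝ) (E := E n) (F := ℂ) (n := k)) 0

/-- The dyadic block `φ(2^{-j} D)` acting on test functions; its values lie in `𝒵`. -/
def testBlock (j : ℤ) : 𝓢(E n, ℂ) →L[ℂ] Z n :=
  (SchwartzMap.fourierMultiplierCLM ℂ (P.symbol j)).codRestrict (Z n)
    (P.fourierMultiplier_mem j)

/-- The homogeneous dyadic block `Δ̇_j u = φ(2^{-j} D) u` of `u ∈ 𝒵'`, a tempered distribution,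
defined by duality: `⟨Δ̇_j u, ψ⟩ = ⟨u, φ(2^{-j} D) ψ⟩` (recall that `φ` is even). -/
def block (j : ℤ) (u : ZDual n) : 𝓢'(E n, ℂ) :=
  ContinuousLinearMap.toPointwiseConvergenceCLM _ _ _ _ (u ∘L P.testBlock j)

end LittlewoodPaley

/-- The `L²` norm of a tempered distribution (`∞` if it is not given by an `L²` function). -/
def l2Norm {n : ℕ} (u : 𝓢'(E n, ℂ)) : ℝ≥0∞ :=
  ⨅ (F : Lp ℂ 2 (volume : Measure (E n))) (_ : (F : 𝓢'(E n, ℂ)) = u), ‖F‖ₑ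

/-- The dyadic weight `2^{ks}`. -/
def dyadicWeight (s : ℝ) (k : ℤ) : ℝ≥0∞ := ENNReal.ofReal ((2 : ℝ) ^ ((k : ℝ) * s))

/-- The hybrid weight: `2^{ks}` at low frequencies `2^k ≤ R₀`, and `2^{kσ}` at high frequencies
`2^k > R₀`. -/
def hybridWeight (R₀ s σ : ℝ) (k : ℤ) : ℝ≥0∞ :=
  if (2 : ℝ) ^ k ≤ R₀ then dyadicWeight s k else dyadicWeight σ k

section Norms

variable {n : ℕ} (P : LittlewoodPaley n)

/-- The norm of the homogeneous Besov space `Ḃ^s_{2,1}`. -/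
def besovNorm (s : ℝ) (u : ZDual n) : ℝ≥0∞ :=
  ∑' k : ℤ, dyadicWeight s k * l2Norm (P.block k u)

/-- The norm of the hybrid Besov space `𝓑^{s,σ}` with frequency threshold `R₀`. -/
def hybridNorm (R₀ s σ : ℝ) (u : ZDual n) : ℝ≥0∞ :=
  ∑' k : ℤ, hybridWeight R₀ s σ k * l2Norm (P.block k u)

/-- Lebesgue measure on the time interval `(0, T)`, `0 < T ≤ ∞`. -/
def timeMeasure (T : ℝ≥0∞) : Measure ℝ :=
  volume.restrict {t : ℝ | 0 < t ∧ ENNReal.ofReal t < T}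

/-- The norm of `Δ̇_k u` in `L^q(0, T; L²)`. -/
def timeBlockNorm (T q : ℝ≥0∞) (k : ℤ) (u : ℝ → ZDual n) : ℝ≥0∞ :=
  eLpNorm (fun t => l2Norm (P.block k (u t))) q (timeMeasure T)

/-- The norm of the Chemin-Lerner space `L̃^q_T Ḃ^s_{2,1}`. -/
def cheminLernerBesovNorm (T q : ℝ≥0∞) (s : ℝ) (u : ℝ → ZDual n) : ℝ≥0∞ :=
  ∑' k : ℤ, dyadicWeight s k * timeBlockNorm P T q k u

/-- The norm of the hybrid Chemin-Lerner space `L̃^q_T 𝓑^{s,σ}`. -/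
def cheminLernerHybridNorm (T q : ℝ≥0∞) (R₀ s σ : ℝ) (u : ℝ → ZDual n) : ℝ≥0∞ :=
  ∑' k : ℤ, hybridWeight R₀ s σ k * timeBlockNorm P T q k u

/-- Weak measurability on `(0, T)` of a time-dependent element of `𝒵'`. -/
def WeaklyMeasurable (T : ℝ≥0∞) (u : ℝ → ZDual n) : Prop :=
  ∀ ψ : Z n, AEMeasurable (fun t => u t ψ) (timeMeasure T)

/-- `F` is the function represented by `u ∈ 𝒵'`: the series `∑_j Δ̇_j u` converges to `F` in the
sense of tempered distributions. Such an `F` is unique up to null sets. (Integrability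
against every Schwartz function contains local integrability.) -/
def Represents (u : ZDual n) (F : E n → ℂ) : Prop :=
  ∀ ψ : 𝓢(E n, ℂ), Integrable (fun x => ψ x * F x) ∧
    HasSum (fun j : ℤ => P.block j u ψ) (∫ x, ψ x * F x)

/-- `h ∈ 𝒵'` is the product `f g`: the elements `f` and `g` are represented by functions `F` and
`G`, and `h` is the class in `𝒵'` of the tempered distribution given by the pointwise product
`F G`. Such an `h` is unique. -/
def IsProduct (f g h : ZDual n) : Prop :=
  ∃ F G : E n → ℂ, Represents P f F ∧ Represents P g G ∧
    (∀ ψ : 𝓢(E n, ℂ), Integrable (fun x => ψ x * (F x * G x))) ∧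
    ∀ ψ : Z n, h ψ = ∫ x, (ψ : 𝓢(E n, ℂ)) x * (F x * G x)

end Norms

end HybridBesov

end

noncomputable section

namespace HybridBesov

/-- `L²(ℝⁿ)`. -/
abbrev L2 (n : ℕ) := Lp ℂ 2 (volume : Measure (E n))

variable {n : ℕ}

theorem coe_L2_injective {F G : L2 n} (h : (F : 𝓢'(E n, ℂ)) = G) : F = G := by
  have := LinearMap.ker_eq_bot.mp
    (Lp.ker_toTemperedDistributionCLM_eq_bot (F := ℂ) (μ := (volume : Measure (E n))) (p := 2))
  exact this h

theorem l2Norm_coe (F : L2 n) : l2Norm (F : 𝓢'(E n, ℂ)) = ‖F‖ₑ := by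
  refine le_antisymm (iInf₂_le (f := fun (G : L2 n) (_ : (G : 𝓢'(E n, ℂ)) = F) => ‖G‖ₑ) F rfl)
    (le_iInf₂ fun G hG => ?_)
  rw [coe_L2_injective hG]

theorem exists_coe_eq_of_l2Norm_lt_top {u : 𝓢'(E n, ℂ)} (h : l2Norm u < ∞) :
    ∃ F : L2 n, (F : 𝓢'(E n, ℂ)) = u := by
  simp only [l2Norm, iInf_lt_iff] at h
  obtain ⟨F, hF, -⟩ := h
  exact ⟨F, hF⟩

theorem norm_star_L2 (F : L2 n) : ‖star F‖ = ‖F‖ := by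
  rw [Lp.norm_def, Lp.norm_def, eLpNorm_congr_ae (Lp.coeFn_star F)]
  congr 1
  exact eLpNorm_congr_norm_ae (.of_forall fun x => by simp)

theorem norm_coe_apply_le (F : L2 n) (ψ : 𝓢(E n, ℂ)) :
    ‖(F : 𝓢'(E n, ℂ)) ψ‖ ≤ ‖F‖ * ‖ψ.toLp 2‖ := by
  have h : (F : 𝓢'(E n, ℂ)) ψ = inner ℂ (star (ψ.toLp 2 volume)) F := by
    rw [Lp.toTemperedDistribution_apply, L2.inner_def]
    refine integral_congr_ae ?_
    filter_upwards [ψ.coeFn_toLp 2 volume, Lp.coeFn_star (ψ.toLp 2 volume)] with x hx hx'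
    simp [hx, hx', mul_comm]
  rw [h, mul_comm]
  refine (norm_inner_le_norm _ _).trans ?_
  rw [norm_star_L2]

/-- A tempered distribution bounded for the `L²` norm is an `L²` function. -/
theorem exists_coe_eq_of_bound {v : 𝓢'(E n, ℂ)} {c : ℝ} (hc : 0 ≤ c)
    (h : ∀ ψ : 𝓢(E n, ℂ), ‖v ψ‖ ≤ c * ‖ψ.toLp 2 volume‖) :
    ∃ F : L2 n, (F : 𝓢'(E n, ℂ)) = v ∧ ‖F‖ ≤ c := by
  have hd : DenseRange (SchwartzMap.toLpCLM ℂ ℂ 2 (volume : Measure (E n))) :=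
    SchwartzMap.denseRange_toLpCLM (p := 2) ENNReal.ofNat_ne_top
  let v' : 𝓢(E n, ℂ) →ₗ[ℂ] ℂ := (v : 𝓢(E n, ℂ) →Lₚₜ[ℂ] ℂ).toLinearMap
  let e : 𝓢(E n, ℂ) →ₗ[ℂ] L2 n := (SchwartzMap.toLpCLM ℂ ℂ 2 (volume : Measure (E n))).toLinearMap
  let Λ : L2 n →L[ℂ] ℂ := v'.extendOfNorm e
  have hΛ (ψ : 𝓢(E n, ℂ)) : Λ (ψ.toLp 2 volume) = v ψ :=
    LinearMap.extendOfNorm_eq (f := v') (e := e) hd ⟨c, h⟩ ψ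
  have hΛn : ‖Λ‖ ≤ c := LinearMap.opNorm_extendOfNorm_le (f := v') (e := e) hd hc h
  refine ⟨star ((InnerProductSpace.toDual ℂ (L2 n)).symm Λ), ?_, ?_⟩
  · ext ψ
    rw [← hΛ ψ, Lp.toTemperedDistribution_apply,
      ← InnerProductSpace.toDual_symm_apply (𝕜 := ℂ) (x := ψ.toLp 2 volume) (y := Λ), L2.inner_def]
    refine integral_congr_ae ?_
    filter_upwards [ψ.coeFn_toLp 2 volume,
      Lp.coeFn_star ((InnerProductSpace.toDual ℂ (L2 n)).symm Λ)] with x hx hx'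
    simp [hx, hx']
  · rw [norm_star_L2, LinearIsometryEquiv.norm_map]
    exact hΛn

theorem l2Norm_le_of_bound {v : 𝓢'(E n, ℂ)} {c : ℝ≥0∞}
    (h : ∀ ψ : 𝓢(E n, ℂ), ‖v ψ‖ₑ ≤ c * ‖ψ.toLp 2 volume‖ₑ) : l2Norm v ≤ c := by
  rcases eq_or_ne c ∞ with rfl | hc
  · exact le_top
  lift c to ℝ≥0 using hc
  obtain ⟨F, rfl, hF⟩ := exists_coe_eq_of_bound (v := v) c.2 fun ψ => by
    have := h ψ
    rw [← ofReal_norm, ← ofReal_norm,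
      ← ENNReal.ofReal_coe_nnreal, ← ENNReal.ofReal_mul (by positivity)] at this
    exact (ENNReal.ofReal_le_ofReal_iff (mul_nonneg c.2 (norm_nonneg _))).mp this
  rw [l2Norm_coe, ← ofReal_norm, ← ENNReal.ofReal_coe_nnreal]
  exact ENNReal.ofReal_le_ofReal hF

/-- The Fourier transform of `F` is supported in the dyadic annulus of radius about `2^j`. -/
def BandLimited (j : ℤ) (F : L2 n) : Prop :=
  ∀ᵐ ξ, (𝓕⁻ F : L2 n) ξ ≠ 0 → (2 : ℝ) ^ j / 16 ≤ ‖ξ‖ ∧ ‖ξ‖ ≤ 2 ^ j / 2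

theorem LittlewoodPaley.norm_of_symbol_ne_zero (P : LittlewoodPaley n) {j : ℤ} {ξ : E n}
    (h : P.symbol j ξ ≠ 0) : (2 : ℝ) ^ j / 16 ≤ ‖ξ‖ ∧ ‖ξ‖ ≤ 2 ^ j / 2 := by
  have h' := P.annulus _ (Complex.ofReal_ne_zero.mp h)
  have hp : (0 : ℝ) < 2 ^ j := by positivity
  rw [norm_smul, Real.norm_of_nonneg (by positivity), zpow_neg] at h'
  obtain ⟨h1, h2⟩ := h'
  have e : ((2 : ℝ) ^ j)⁻¹ * (2 * Real.pi) * ‖ξ‖ = 2 * Real.pi * ‖ξ‖ / 2 ^ j := by ring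
  rw [e, le_div_iff₀ hp] at h1
  rw [e, div_le_iff₀ hp] at h2
  have := Real.pi_gt_three
  have := Real.pi_lt_four
  have hξ := norm_nonneg ξ
  constructor
  · nlinarith
  · nlinarith

theorem LittlewoodPaley.block_apply (P : LittlewoodPaley n) (j : ℤ) (u : ZDual n)
    (ψ : 𝓢(E n, ℂ)) : P.block j u ψ = u (P.testBlock j ψ) := rfl

theorem LittlewoodPaley.coe_testBlock (P : LittlewoodPaley n) (j : ℤ) (ψ : 𝓢(E n, ℂ)) :
    (P.testBlock j ψ : 𝓢(E n, ℂ)) = 𝓕⁻ (SchwartzMap.smulLeftCLM ℂ (P.symbol j) (𝓕 ψ)) := rfl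

theorem LittlewoodPaley.fourier_testBlock (P : LittlewoodPaley n) (j : ℤ) (ψ : 𝓢(E n, ℂ))
    (ξ : E n) : 𝓕 (P.testBlock j ψ : 𝓢(E n, ℂ)) ξ = P.symbol j ξ * 𝓕 ψ ξ := by
  rw [P.coe_testBlock, FourierTransform.fourier_fourierInv_eq,
    SchwartzMap.smulLeftCLM_apply_apply (P.symbol_hasTemperateGrowth j), smul_eq_mul]

theorem LittlewoodPaley.bandLimited_of_coe_eq_block (P : LittlewoodPaley n) {j : ℤ} {u : ZDual n}
    {F : L2 n} (h : (F : 𝓢'(E n, ℂ)) = P.block j u) : BandLimited j F := by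
  let K : Set (E n) := {ξ | (2 : ℝ) ^ j / 16 ≤ ‖ξ‖ ∧ ‖ξ‖ ≤ 2 ^ j / 2}
  have hK : IsClosed K := by
    apply IsClosed.and
    · exact isClosed_le continuous_const continuous_norm
    · exact isClosed_le continuous_norm continuous_const
  have key := hK.isOpen_compl.ae_eq_zero_of_integral_contDiff_smul_eq_zero
    (f := ((𝓕⁻ F : L2 n) : E n → ℂ)) (μ := volume)
    (((Lp.memLp (𝓕⁻ F : L2 n)).locallyIntegrable (by norm_num)).locallyIntegrableOn _) ?_
  · filter_upwards [key] with ξ hξ h0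
    by_contra hc
    exact h0 (hξ hc)
  · intro g hg hgc hgs
    have hg₁ : HasCompactSupport (Complex.ofRealCLM ∘ g) := hgc.comp_left rfl
    have hg₂ : ContDiff ℝ (⊤ : ℕ∞) (Complex.ofRealCLM ∘ g) := by fun_prop
    let ψ : 𝓢(E n, ℂ) := hg₁.toSchwartzMap hg₂
    have h1 : ∫ x, g x • (𝓕⁻ F : L2 n) x = ((𝓕⁻ F : L2 n) : 𝓢'(E n, ℂ)) ψ := by
      rw [Lp.toTemperedDistribution_apply]
      simp [ψ]
    have h2 : SchwartzMap.smulLeftCLM ℂ (P.symbol j) ψ = 0 := by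
      ext ξ
      rw [SchwartzMap.smulLeftCLM_apply_apply (P.symbol_hasTemperateGrowth j)]
      by_cases hs : P.symbol j ξ = 0
      · simp [hs]
      · have : ξ ∉ tsupport g := fun hξ => hgs hξ (P.norm_of_symbol_ne_zero hs)
        have := image_eq_zero_of_notMem_tsupport this
        simp [ψ, this]
    rw [h1, ← Lp.fourierInv_toTemperedDistribution_eq, TemperedDistribution.fourierInv_apply, h,
      P.block_apply]
    have h3 : P.testBlock j (𝓕⁻ ψ) = 0 := by
      ext1
      rw [P.coe_testBlock, FourierTransform.fourier_fourierInv_eq, h2]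
      exact (FourierTransform.fourierInvCLM ℂ 𝓢(E n, ℂ)).map_zero
    rw [h3, map_zero]

theorem LittlewoodPaley.bandLimited_testBlock (P : LittlewoodPaley n) (j : ℤ) (ψ : 𝓢(E n, ℂ)) :
    BandLimited j ((P.testBlock j ψ : 𝓢(E n, ℂ)).toLp 2 volume) := by
  rw [BandLimited, SchwartzMap.toLp_fourierInv_eq]
  filter_upwards [(𝓕⁻ (P.testBlock j ψ : 𝓢(E n, ℂ))).coeFn_toLp 2 volume] with ξ hξ h0
  rw [hξ] at h0
  have e : (𝓕⁻ (P.testBlock j ψ : 𝓢(E n, ℂ)) : 𝓢(E n, ℂ)) ξ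
      = 𝓕 (P.testBlock j ψ : 𝓢(E n, ℂ)) (-ξ) := rfl
  rw [e, P.fourier_testBlock] at h0
  simpa using P.norm_of_symbol_ne_zero (left_ne_zero_of_mul h0)

/-- The constant in Bernstein's inequality. -/
def bernsteinConst (n : ℕ) : ℝ := (volume (Metric.ball (0 : E n) 1)).toReal ^ (1 / 2 : ℝ)

theorem bernsteinConst_nonneg : 0 ≤ bernsteinConst n := by unfold bernsteinConst; positivity

theorem BandLimited.lintegral_le {j : ℤ} {F : L2 n} (h : BandLimited j F) :
    ∫⁻ ξ, ‖(𝓕⁻ F : L2 n) ξ‖ₑ ≤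
      ENNReal.ofReal (bernsteinConst n * (2 : ℝ) ^ ((j : ℝ) * (n / 2)) * ‖F‖) := by
  set f := (𝓕⁻ F : L2 n) with hf
  have hfn : ‖f‖ = ‖F‖ := (Lp.fourierTransformₗᵢ (E n) ℂ).symm.norm_map F
  set B := Metric.closedBall (0 : E n) ((2 : ℝ) ^ j) with hB
  have h1 : ∫⁻ ξ, ‖f ξ‖ₑ = eLpNorm f 1 (volume.restrict B) := by
    rw [eLpNorm_one_eq_lintegral_enorm, ← lintegral_indicator Metric.isClosed_closedBall.measurableSet]
    refine lintegral_congr_ae ?_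
    filter_upwards [h] with ξ hξ
    by_cases hx : f ξ = 0
    · have : ‖f ξ‖ₑ = 0 := by simp [hx]
      rw [this, eq_comm, Set.indicator_apply_eq_zero]
      exact fun _ => this
    · rw [Set.indicator_of_mem]
      have : (0 : ℝ) < 2 ^ j := by positivity
      rw [mem_closedBall_zero_iff]
      linarith [(hξ hx).2]
  rw [h1]
  have h2 := eLpNorm_le_eLpNorm_mul_rpow_measure_univ (μ := volume.restrict B) (p := 1) (q := 2)
    (f := f) (by norm_num) (Lp.aestronglyMeasurable f).restrict
  refine h2.trans ?_
  have h3 : eLpNorm f 2 (volume.restrict B) ≤ ENNReal.ofReal ‖F‖ := by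
    rw [← hfn, ofReal_norm, Lp.enorm_def]
    exact eLpNorm_mono_measure _ Measure.restrict_le_self
  have h4 : (volume.restrict B) Set.univ
      = ENNReal.ofReal (((2 : ℝ) ^ j) ^ n * (volume (Metric.ball (0 : E n) 1)).toReal) := by
    rw [Measure.restrict_apply_univ, hB, Measure.addHaar_closedBall _ _ (by positivity),
      ENNReal.ofReal_mul (by positivity), ENNReal.ofReal_toReal measure_ball_lt_top.ne]
    simp
  rw [h4, ENNReal.ofReal_rpow_of_nonneg
    (mul_nonneg (pow_nonneg (by positivity) n) ENNReal.toReal_nonneg) (by norm_num), mul_comm,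
    ENNReal.ofReal_mul (by unfold bernsteinConst; positivity)]
  refine mul_le_mul' (le_of_eq ?_) h3
  congr 1
  have hp : (0 : ℝ) ≤ 2 ^ j := by positivity
  rw [Real.mul_rpow (pow_nonneg hp n) ENNReal.toReal_nonneg, mul_comm]
  norm_num
  congr 1
  rw [← Real.rpow_natCast, ← Real.rpow_intCast, ← Real.rpow_mul (zero_le_two : (0:ℝ) ≤ 2),
    ← Real.rpow_mul (zero_le_two : (0:ℝ) ≤ 2)]
  congr 1
  ring

theorem BandLimited.integrable {j : ℤ} {F : L2 n} (h : BandLimited j F) :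
    Integrable (𝓕⁻ F : L2 n) :=
  ⟨Lp.aestronglyMeasurable _, h.lintegral_le.trans_lt ENNReal.ofReal_lt_top⟩

theorem integral_fourier_mul_eq' {f g : E n → ℂ} (hf : Integrable f) (hg : Integrable g) :
    ∫ ξ, 𝓕 f ξ * g ξ = ∫ x, f x * 𝓕 g x := by
  simpa using! VectorFourier.integral_bilin_fourierIntegral_eq_flip (.mul ℂ ℂ) (L := innerₗ (E n))
    Real.continuous_fourierChar continuous_inner hf hg

theorem norm_fourier_le_integral {f : E n → ℂ} (x : E n) :
    ‖𝓕 f x‖ ≤ ∫ ξ, ‖f ξ‖ :=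
  VectorFourier.norm_fourierIntegral_le_integral_norm _ _ _ _ _

theorem continuous_fourier_of_integrable {f : E n → ℂ} (hf : Integrable f) :
    Continuous (𝓕 f) :=
  VectorFourier.fourierIntegral_continuous Real.continuous_fourierChar
    (by exact continuous_inner) hf

theorem BandLimited.ae_eq_fourier {j : ℤ} {F : L2 n} (h : BandLimited j F) :
    F =ᵐ[volume] 𝓕 ((𝓕⁻ F : L2 n) : E n → ℂ) := by
  set f := (𝓕⁻ F : L2 n) with hf
  have hc := continuous_fourier_of_integrable h.integrable
  refine ae_eq_of_integral_contDiff_smul_eq ((Lp.memLp F).locallyIntegrable (by norm_num))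
    hc.locallyIntegrable fun g hg hgc => ?_
  have hg₁ : HasCompactSupport (Complex.ofRealCLM ∘ g) := hgc.comp_left rfl
  have hg₂ : ContDiff ℝ (⊤ : ℕ∞) (Complex.ofRealCLM ∘ g) := by fun_prop
  let ψ : 𝓢(E n, ℂ) := hg₁.toSchwartzMap hg₂
  have h1 : ∫ x, g x • F x = (F : 𝓢'(E n, ℂ)) ψ := by
    rw [Lp.toTemperedDistribution_apply]
    simp [ψ]
  have h2 : F = (𝓕 f : L2 n) := (FourierTransform.fourier_fourierInv_eq F).symm
  have h3 : ∫ x, g x • 𝓕 (f : E n → ℂ) x = ∫ x, 𝓕 (f : E n → ℂ) x * ψ x := by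
    refine integral_congr_ae (.of_forall fun x => ?_)
    simp [ψ, mul_comm]
  rw [h1, h3, integral_fourier_mul_eq' h.integrable ψ.integrable]
  conv_lhs => rw [h2]
  rw [← Lp.fourier_toTemperedDistribution_eq, TemperedDistribution.fourier_apply,
    Lp.toTemperedDistribution_apply]
  refine integral_congr_ae (.of_forall fun x => ?_)
  simp [mul_comm, SchwartzMap.fourier_coe, hf]

/-- **Bernstein's inequality**. -/
theorem BandLimited.ae_norm_le {j : ℤ} {F : L2 n} (h : BandLimited j F) :
    ∀ᵐ x, ‖F x‖ ≤ bernsteinConst n * (2 : ℝ) ^ ((j : ℝ) * (n / 2)) * ‖F‖ := by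
  filter_upwards [h.ae_eq_fourier] with x hx
  rw [hx]
  refine (norm_fourier_le_integral x).trans ?_
  rw [integral_norm_eq_lintegral_enorm h.integrable.1]
  exact ENNReal.toReal_le_of_le_ofReal
    (mul_nonneg (mul_nonneg bernsteinConst_nonneg (by positivity)) (norm_nonneg _)) h.lintegral_le

theorem lintegral_enorm_mul_enorm_le (A F : L2 n) :
    ∫⁻ x, ‖A x‖ₑ * ‖F x‖ₑ ≤ ‖A‖ₑ * ‖F‖ₑ := by
  have h := eLpNorm_smul_le_mul_eLpNorm (p := 2) (q := 2) (r := 1)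
    (Lp.aestronglyMeasurable F) (Lp.aestronglyMeasurable A)
  rw [eLpNorm_one_eq_lintegral_enorm] at h
  rw [Lp.enorm_def, Lp.enorm_def]
  refine le_trans (le_of_eq ?_) h
  refine lintegral_congr fun x => ?_
  simp

theorem lintegral_triple_le_of_ae_le (A F G : L2 n) {B : ℝ} (h : ∀ᵐ x, ‖G x‖ ≤ B * ‖G‖) :
    ∫⁻ x, ‖A x‖ₑ * ‖F x‖ₑ * ‖G x‖ₑ ≤ ENNReal.ofReal B * (‖A‖ₑ * ‖F‖ₑ * ‖G‖ₑ) := by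
  calc ∫⁻ x, ‖A x‖ₑ * ‖F x‖ₑ * ‖G x‖ₑ
      ≤ ∫⁻ x, ‖A x‖ₑ * ‖F x‖ₑ * (ENNReal.ofReal B * ‖G‖ₑ) := by
        refine lintegral_mono_ae ?_
        filter_upwards [h] with x hx
        gcongr
        rw [← ofReal_norm, ← ofReal_norm, ← ENNReal.ofReal_mul' (norm_nonneg _)]
        exact ENNReal.ofReal_le_ofReal hx
    _ = (∫⁻ x, ‖A x‖ₑ * ‖F x‖ₑ) * (ENNReal.ofReal B * ‖G‖ₑ) := by
        rw [lintegral_mul_const' _ _ (by finiteness)]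
    _ ≤ ‖A‖ₑ * ‖F‖ₑ * (ENNReal.ofReal B * ‖G‖ₑ) := by
        gcongr
        exact lintegral_enorm_mul_enorm_le A F
    _ = _ := by ring

/-- The factor in the estimate for products of three band-limited functions. -/
def tripleFactor (n : ℕ) (k i j : ℤ) : ℝ :=
  bernsteinConst n * (2 : ℝ) ^ (((min k (min i j) : ℤ) : ℝ) * (n / 2))

theorem lintegral_triple_le {k i j : ℤ} {A F G : L2 n} (hA : BandLimited k A)
    (hF : BandLimited i F) (hG : BandLimited j G) :
    ∫⁻ x, ‖A x‖ₑ * ‖F x‖ₑ * ‖G x‖ₑ ≤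
      ENNReal.ofReal (tripleFactor n k i j) * (‖A‖ₑ * ‖F‖ₑ * ‖G‖ₑ) := by
  unfold tripleFactor
  rcases min_choice k (min i j) with h | h <;> rw [h]
  · refine le_trans (le_of_eq ?_) ((lintegral_triple_le_of_ae_le F G A hA.ae_norm_le).trans_eq ?_)
    · congr with x
      ring
    · ring
  rcases min_choice i j with h | h <;> rw [h]
  · refine le_trans (le_of_eq ?_) ((lintegral_triple_le_of_ae_le A G F hF.ae_norm_le).trans_eq ?_)
    · congr with x
      ring
    · ring
  · exact lintegral_triple_le_of_ae_le A F G hG.ae_norm_le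

/-- No index exceeds both others by more than `4`. -/
def Compatible (k i j : ℤ) : Prop := k ≤ max i j + 4 ∧ i ≤ max k j + 4 ∧ j ≤ max k i + 4

theorem le_max_add_four {k i j : ℤ} {a b c : ℝ} (h1 : (2 : ℝ) ^ k / 16 ≤ a) (h2 : b ≤ 2 ^ i / 2)
    (h3 : c ≤ 2 ^ j / 2) (h : a ≤ b + c) : k ≤ max i j + 4 := by
  have hi : (2 : ℝ) ^ i ≤ 2 ^ (max i j) := zpow_le_zpow_right₀ (by norm_num) (le_max_left _ _)
  have hj : (2 : ℝ) ^ j ≤ 2 ^ (max i j) := zpow_le_zpow_right₀ (by norm_num) (le_max_right _ _)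
  have : (2 : ℝ) ^ k ≤ 2 ^ (max i j + 4) := by
    rw [zpow_add₀ (by norm_num)]
    norm_num
    linarith
  exact (zpow_le_zpow_iff_right₀ (by norm_num)).mp this

theorem fourier_mul_fourier_eq (A : 𝓢(E n, ℂ)) {f : E n → ℂ} (hf : Integrable f) (η : E n) :
    𝓕 (fun x => A x * 𝓕 f x) η = ∫ ξ, 𝓕 A (ξ + η) * f ξ := by
  have h1 : Integrable fun x => (Real.fourierChar (-inner ℝ x η) : ℂ) * A x := by
    have := (Real.fourierIntegral_convergent_iff (f := A) (μ := volume) η).mpr A.integrable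
    simpa [Circle.smul_def] using this
  have h2 : ∀ ξ, 𝓕 (fun x => (Real.fourierChar (-inner ℝ x η) : ℂ) * A x) ξ = 𝓕 A (ξ + η) := by
    intro ξ
    rw [SchwartzMap.fourier_coe, Real.fourier_eq, Real.fourier_eq]
    refine integral_congr_ae (.of_forall fun x => ?_)
    simp only [Circle.smul_def, smul_eq_mul, inner_add_right, neg_add, AddChar.map_add_eq_mul,
      Circle.coe_mul]
    ring
  simp_rw [← h2]
  rw [integral_fourier_mul_eq' h1 hf, Real.fourier_eq]
  refine integral_congr_ae (.of_forall fun x => ?_)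
  simp only [Circle.smul_def, smul_eq_mul]
  ring

theorem LittlewoodPaley.integral_triple_eq_zero (P : LittlewoodPaley n) {k i j : ℤ}
    {ψ : 𝓢(E n, ℂ)} {F G : L2 n} (hF : BandLimited i F) (hG : BandLimited j G)
    (h : ¬ Compatible k i j) :
    ∫ x, (P.testBlock k ψ : 𝓢(E n, ℂ)) x * (F x * G x) = 0 := by
  set A : 𝓢(E n, ℂ) := (P.testBlock k ψ : 𝓢(E n, ℂ)) with hA
  set f := (𝓕⁻ F : L2 n)
  set g := (𝓕⁻ G : L2 n)
  have hAF : Integrable fun x => A x * 𝓕 (f : E n → ℂ) x := by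
    refine A.integrable.mul_bdd (c := ∫ ξ, ‖f ξ‖)
      (continuous_fourier_of_integrable hF.integrable).aestronglyMeasurable
      (.of_forall fun x => norm_fourier_le_integral x)
  have h1 : ∫ x, A x * (F x * G x)
      = ∫ x, (fun x => A x * 𝓕 (f : E n → ℂ) x) x * 𝓕 (g : E n → ℂ) x := by
    refine integral_congr_ae ?_
    filter_upwards [hF.ae_eq_fourier, hG.ae_eq_fourier] with x hx hx'
    rw [hx, hx', mul_assoc]
  rw [h1, ← integral_fourier_mul_eq' hAF hG.integrable]
  refine integral_eq_zero_of_ae ?_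
  filter_upwards [hG] with η hη
  by_cases hgη : g η = 0
  · exact mul_eq_zero_of_right _ hgη
  have hη := hη hgη
  rw [Pi.zero_apply, fourier_mul_fourier_eq A hF.integrable]
  rw [integral_eq_zero_of_ae, zero_mul]
  filter_upwards [hF] with ξ hξ
  by_cases hfξ : f ξ = 0
  · exact mul_eq_zero_of_right _ hfξ
  have hξ := hξ hfξ
  rw [hA, P.fourier_testBlock, Pi.zero_apply]
  by_cases hs : P.symbol k (ξ + η) = 0
  · simp [hs]
  have hk := P.norm_of_symbol_ne_zero hs
  refine absurd ⟨?_, ?_, ?_⟩ h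
  · exact le_max_add_four hk.1 hξ.2 hη.2 (norm_add_le _ _)
  · refine le_max_add_four hξ.1 hk.2 hη.2 ?_
    simpa using norm_sub_le (ξ + η) η
  · refine le_max_add_four hη.1 hk.2 hξ.2 ?_
    simpa using norm_sub_le (ξ + η) ξ

theorem LittlewoodPaley.exists_bound (P : LittlewoodPaley n) :
    ∃ M : ℝ, 0 ≤ M ∧ ∀ ξ, |P.φ ξ| ≤ M := by
  have hφ : HasCompactSupport P.φ := by
    refine HasCompactSupport.intro (isCompact_closedBall (0 : E n) (8 / 3)) ?_
    intro x hx
    by_contra h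
    exact hx (by simpa using (P.annulus x h).2)
  obtain ⟨M, hM⟩ := hφ.exists_bound_of_continuous P.smooth.continuous
  exact ⟨M, (norm_nonneg _).trans (hM 0), hM⟩

/-- A bound for the Littlewood-Paley function. -/
def LittlewoodPaley.bound (P : LittlewoodPaley n) : ℝ := P.exists_bound.choose

theorem LittlewoodPaley.bound_nonneg (P : LittlewoodPaley n) : 0 ≤ P.bound :=
  P.exists_bound.choose_spec.1

theorem LittlewoodPaley.norm_symbol_le (P : LittlewoodPaley n) (j : ℤ) (ξ : E n) :
    ‖P.symbol j ξ‖ ≤ P.bound := by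
  rw [symbol, Complex.norm_real]
  exact P.exists_bound.choose_spec.2 _

theorem LittlewoodPaley.norm_testBlock_le (P : LittlewoodPaley n) (j : ℤ) (ψ : 𝓢(E n, ℂ)) :
    ‖(P.testBlock j ψ : 𝓢(E n, ℂ)).toLp 2 volume‖ ≤ P.bound * ‖ψ.toLp 2 volume‖ := by
  rw [← SchwartzMap.norm_fourier_toL2_eq, ← SchwartzMap.norm_fourier_toL2_eq ψ]
  refine Lp.norm_le_mul_norm_of_ae_le_mul ?_
  filter_upwards [(𝓕 (P.testBlock j ψ : 𝓢(E n, ℂ))).coeFn_toLp 2 volume,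
    (𝓕 ψ).coeFn_toLp 2 volume] with ξ h1 h2
  rw [h1, h2, P.fourier_testBlock, norm_mul]
  gcongr
  exact P.norm_symbol_le _ _

open Classical in
/-- The basic estimate for the frequency interactions in a product. -/
theorem LittlewoodPaley.enorm_integral_triple_le (P : LittlewoodPaley n) {k i j : ℤ}
    (ψ : 𝓢(E n, ℂ)) {F G : L2 n} (hF : BandLimited i F) (hG : BandLimited j G) :
    ‖∫ x, (P.testBlock k ψ : 𝓢(E n, ℂ)) x * (F x * G x)‖ₑ ≤
      ENNReal.ofReal (if Compatible k i j then P.bound * tripleFactor n k i j else 0) *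
        (‖F‖ₑ * ‖G‖ₑ) * ‖ψ.toLp 2 volume‖ₑ := by
  split_ifs with h
  · refine (enorm_integral_le_lintegral_enorm _).trans ?_
    have h1 := lintegral_triple_le (P.bandLimited_testBlock k ψ) hF hG
    have h2 : ‖(P.testBlock k ψ : 𝓢(E n, ℂ)).toLp 2 volume‖ₑ
        ≤ ENNReal.ofReal P.bound * ‖ψ.toLp 2 volume‖ₑ := by
      rw [← ofReal_norm, ← ofReal_norm, ← ENNReal.ofReal_mul P.bound_nonneg]
      exact ENNReal.ofReal_le_ofReal (P.norm_testBlock_le k ψ)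
    calc _ = ∫⁻ x, ‖(P.testBlock k ψ : 𝓢(E n, ℂ)).toLp 2 volume x‖ₑ * ‖F x‖ₑ * ‖G x‖ₑ := by
          refine lintegral_congr_ae ?_
          filter_upwards [(P.testBlock k ψ : 𝓢(E n, ℂ)).coeFn_toLp 2 volume] with x hx
          rw [hx, enorm_mul, enorm_mul, mul_assoc]
      _ ≤ _ := h1
      _ ≤ ENNReal.ofReal (tripleFactor n k i j) *
          ((ENNReal.ofReal P.bound * ‖ψ.toLp 2 volume‖ₑ) * ‖F‖ₑ * ‖G‖ₑ) := by gcongr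
      _ = _ := by
          rw [ENNReal.ofReal_mul P.bound_nonneg]
          ring
  · rw [P.integral_triple_eq_zero hF hG h]
    simp

theorem exponent_aux {d k i j m : ℝ} (hd : 1 ≤ d) (hk : k ≤ j + 4) (hmk : m ≤ k) (hmi : m ≤ i)
    (h : j ≤ k + 4 ∨ j ≤ i + 4) :
    k * (d - 1) + m * d + |k - j| ≤ 12 * d + (i * d + j * (d - 1)) := by
  rcases h with h | h
  · have h1 : |k - j| ≤ 4 := abs_le.mpr ⟨by linarith, by linarith⟩
    nlinarith [mul_nonneg (sub_nonneg.mpr hd) (sub_nonneg.mpr hk),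
      mul_nonneg (zero_le_one.trans hd) (sub_nonneg.mpr hmi)]
  · rcases abs_cases (k - j) with ⟨h1, h2⟩ | ⟨h1, h2⟩ <;> rw [h1]
    · nlinarith [mul_nonneg (sub_nonneg.mpr hd) (sub_nonneg.mpr hk),
        mul_nonneg (zero_le_one.trans hd) (sub_nonneg.mpr hmk),
        mul_nonneg (zero_le_one.trans hd) (sub_nonneg.mpr h),
        mul_nonneg (zero_le_one.trans hd) (sub_nonneg.mpr hk)]
    · nlinarith [mul_nonneg (sub_nonneg.mpr hd) (neg_nonneg.mpr h2.le),
        mul_nonneg (zero_le_one.trans hd) (sub_nonneg.mpr hmk),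
        mul_nonneg (zero_le_one.trans hd) (sub_nonneg.mpr h)]

theorem Compatible.exponent_le {k i j : ℤ} (h : Compatible k i j) {d : ℝ} (hd : 1 ≤ d) :
    (k : ℝ) * (d - 1) + ((min k (min i j) : ℤ) : ℝ) * d + ((|k - max i j| : ℤ) : ℝ)
      + max (i : ℝ) 0 - max (j : ℝ) 0 ≤ 12 * d + (i * d + j * (d - 1)) := by
  obtain ⟨h1, h2, h3⟩ := h
  have hmk : ((min k (min i j) : ℤ) : ℝ) ≤ k := by exact_mod_cast min_le_left _ _
  have hmi : ((min k (min i j) : ℤ) : ℝ) ≤ i := by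
    exact_mod_cast (min_le_right _ _).trans (min_le_left _ _)
  have hmj : ((min k (min i j) : ℤ) : ℝ) ≤ j := by
    exact_mod_cast (min_le_right _ _).trans (min_le_right _ _)
  rcases le_total i j with hij | hij
  · rw [max_eq_right hij] at h1 ⊢
    have a1 : (k : ℝ) ≤ j + 4 := by exact_mod_cast h1
    have a2 : (j : ℝ) ≤ k + 4 ∨ (j : ℝ) ≤ i + 4 := by
      rcases le_total k i with hc | hc
      · rw [max_eq_right hc] at h3
        exact .inr (by exact_mod_cast h3)
      · rw [max_eq_left hc] at h3
        exact .inl (by exact_mod_cast h3)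
    have a3 : max (i : ℝ) 0 ≤ max (j : ℝ) 0 := max_le_max_right _ (by exact_mod_cast hij)
    have := exponent_aux hd a1 hmk hmi a2
    push_cast at this ⊢
    linarith
  · rw [max_eq_left hij] at h1 ⊢
    have a1 : (k : ℝ) ≤ i + 4 := by exact_mod_cast h1
    have a2 : (i : ℝ) ≤ k + 4 ∨ (i : ℝ) ≤ j + 4 := by
      rcases le_total k j with hc | hc
      · rw [max_eq_right hc] at h2
        exact .inr (by exact_mod_cast h2)
      · rw [max_eq_left hc] at h2
        exact .inl (by exact_mod_cast h2)
    have hij' : (j : ℝ) ≤ i := by exact_mod_cast hij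
    have a3 : max (i : ℝ) 0 ≤ max (j : ℝ) 0 + (i - j) :=
      max_le (by linarith [le_max_left (j : ℝ) 0]) (by linarith [le_max_right (j : ℝ) 0])
    have := exponent_aux hd a1 hmk hmj a2
    push_cast at this ⊢
    linarith

/-- The hybrid weight as a real number. -/
def realWeight (R₀ s σ : ℝ) (k : ℤ) : ℝ :=
  if (2 : ℝ) ^ k ≤ R₀ then (2 : ℝ) ^ ((k : ℝ) * s) else (2 : ℝ) ^ ((k : ℝ) * σ)

theorem hybridWeight_eq (R₀ s σ : ℝ) (k : ℤ) :
    hybridWeight R₀ s σ k = ENNReal.ofReal (realWeight R₀ s σ k) := by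
  unfold hybridWeight realWeight dyadicWeight
  split_ifs <;> rfl

theorem realWeight_pos (R₀ s σ : ℝ) (k : ℤ) : 0 < realWeight R₀ s σ k := by
  unfold realWeight
  split_ifs <;> positivity

theorem two_zpow_le_iff {R₀ : ℝ} (hR₀ : 0 < R₀) (k : ℤ) :
    (2 : ℝ) ^ k ≤ R₀ ↔ (k : ℝ) ≤ Real.logb 2 R₀ := by
  rw [Real.le_logb_iff_rpow_le (by norm_num) hR₀, Real.rpow_intCast]

theorem le_realWeight_low (R₀ d : ℝ) (i : ℤ) :
    (2 : ℝ) ^ ((i : ℝ) * d - max (i : ℝ) 0 - |Real.logb 2 R₀|) ≤ realWeight R₀ d (d - 1) i := by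
  unfold realWeight
  have h1 := abs_nonneg (Real.logb 2 R₀)
  have h2 := neg_abs_le (Real.logb 2 R₀)
  have h3 := le_max_left (i : ℝ) 0
  have h4 := le_max_right (i : ℝ) 0
  split_ifs with h
  · exact Real.rpow_le_rpow_of_exponent_le (by norm_num) (by linarith)
  · exact Real.rpow_le_rpow_of_exponent_le (by norm_num) (by linarith)

theorem le_realWeight_high {R₀ : ℝ} (hR₀ : 0 < R₀) (d : ℝ) (j : ℤ) :
    (2 : ℝ) ^ ((j : ℝ) * (d - 1) + max (j : ℝ) 0 - |Real.logb 2 R₀|) ≤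
      realWeight R₀ (d - 1) d j := by
  unfold realWeight
  have h1 := abs_nonneg (Real.logb 2 R₀)
  have h2 := neg_abs_le (Real.logb 2 R₀)
  have h3 := le_abs_self (Real.logb 2 R₀)
  split_ifs with h
  · rw [two_zpow_le_iff hR₀] at h
    have : max (j : ℝ) 0 ≤ |Real.logb 2 R₀| := max_le (h.trans h3) h1
    exact Real.rpow_le_rpow_of_exponent_le (by norm_num) (by linarith)
  · rw [two_zpow_le_iff hR₀, not_le] at h
    have : max (j : ℝ) 0 ≤ j + |Real.logb 2 R₀| := max_le (by linarith) (by linarith)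
    exact Real.rpow_le_rpow_of_exponent_le (by norm_num) (by linarith)

/-- The constant in the comparison of the weights. -/
def weightConst (R₀ d : ℝ) : ℝ := (2 : ℝ) ^ (12 * d + 2 * |Real.logb 2 R₀|)

theorem Compatible.weight_le {k i j : ℤ} (h : Compatible k i j) {R₀ d : ℝ} (hR₀ : 0 < R₀)
    (hd : 1 ≤ d) :
    (2 : ℝ) ^ ((k : ℝ) * (d - 1)) * (2 : ℝ) ^ (((min k (min i j) : ℤ) : ℝ) * d) ≤
      weightConst R₀ d * (2 : ℝ) ^ (-((|k - max i j| : ℤ) : ℝ)) *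
        (realWeight R₀ d (d - 1) i * realWeight R₀ (d - 1) d j) := by
  have h1 := le_realWeight_low R₀ d i
  have h2 := le_realWeight_high hR₀ d j
  refine le_trans ?_ (mul_le_mul_of_nonneg_left (mul_le_mul h1 h2 (by positivity)
    (realWeight_pos _ _ _ _).le) (by unfold weightConst; positivity))
  unfold weightConst
  have h0 : (0 : ℝ) < 2 := by norm_num
  rw [← Real.rpow_add h0, ← Real.rpow_add h0, ← Real.rpow_add h0, ← Real.rpow_add h0]
  refine Real.rpow_le_rpow_of_exponent_le (by norm_num) ?_
  linarith [h.exponent_le hd]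

/-- The geometric weights `2^{-|k|}`. -/
def decay (k : ℤ) : ℝ≥0∞ := ENNReal.ofReal ((2 : ℝ) ^ (-((|k| : ℤ) : ℝ)))

theorem tsum_decay_lt_top : ∑' k : ℤ, decay k < ∞ := by
  have hs : Summable fun k : ℤ => (2 : ℝ) ^ (-((|k| : ℤ) : ℝ)) := by
    have hg : Summable fun m : ℕ => (2 : ℝ) ^ (-(m : ℝ)) := by
      have : (fun m : ℕ => (2 : ℝ) ^ (-(m : ℝ))) = fun m : ℕ => ((1 : ℝ) / 2) ^ m := by
        funext m
        rw [Real.rpow_neg (by norm_num), Real.rpow_natCast]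
        simp
      rw [this]
      exact summable_geometric_two
    refine Summable.of_nat_of_neg ?_ ?_ <;> simpa using hg
  exact hs.tsum_ofReal_lt_top

theorem tsum_decay_sub (m : ℤ) : ∑' k : ℤ, decay (k - m) = ∑' k : ℤ, decay k :=
  (Equiv.subRight m).tsum_eq decay

open Classical in
theorem LittlewoodPaley.dyadicWeight_mul_le (P : LittlewoodPaley n) (hn : 2 ≤ n) {R₀ : ℝ}
    (hR₀ : 0 < R₀) (k i j : ℤ) :
    dyadicWeight ((n : ℝ) / 2 - 1) k *
        ENNReal.ofReal (if Compatible k i j then P.bound * tripleFactor n k i j else 0) ≤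
      ENNReal.ofReal (P.bound * bernsteinConst n * weightConst R₀ ((n : ℝ) / 2)) *
        decay (k - max i j) *
        (hybridWeight R₀ ((n : ℝ) / 2) ((n : ℝ) / 2 - 1) i *
          hybridWeight R₀ ((n : ℝ) / 2 - 1) ((n : ℝ) / 2) j) := by
  split_ifs with h
  · have hd : (1 : ℝ) ≤ (n : ℝ) / 2 := by
      rw [le_div_iff₀ (by norm_num)]
      exact_mod_cast (by omega : 1 * 2 ≤ n)
    have h1 := h.weight_le hR₀ hd
    have hb := mul_nonneg P.bound_nonneg (bernsteinConst_nonneg (n := n))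
    have hw : 0 ≤ weightConst R₀ ((n : ℝ) / 2) := by unfold weightConst; positivity
    rw [hybridWeight_eq, hybridWeight_eq, dyadicWeight, decay,
      ← ENNReal.ofReal_mul (realWeight_pos _ _ _ _).le,
      ← ENNReal.ofReal_mul (mul_nonneg hb hw), ← ENNReal.ofReal_mul (by positivity),
      ← ENNReal.ofReal_mul (mul_nonneg (mul_nonneg hb hw) (by positivity))]
    refine ENNReal.ofReal_le_ofReal ?_
    unfold tripleFactor
    calc _ = (P.bound * bernsteinConst n) * ((2 : ℝ) ^ ((k : ℝ) * ((n : ℝ) / 2 - 1)) *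
          (2 : ℝ) ^ (((min k (min i j) : ℤ) : ℝ) * ((n : ℝ) / 2))) := by ring
      _ ≤ _ := mul_le_mul_of_nonneg_left h1 hb
      _ = _ := by ring
  · simp

section Series

variable {α ι : Type*} [MeasurableSpace α] {μ : Measure α} [Countable ι] {f : ι → α → ℂ}

theorem summable_of_tsum_enorm_ne_top {κ V : Type*} [NormedAddCommGroup V] [CompleteSpace V]
    {a : κ → V} (h : ∑' i, ‖a i‖ₑ ≠ ∞) : Summable a := by
  refine Summable.of_nnnorm ?_
  rw [← ENNReal.tsum_coe_ne_top_iff_summable]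
  exact h

theorem aestronglyMeasurable_tsum (hf : ∀ i, AEStronglyMeasurable (f i) μ)
    (h : ∀ᵐ x ∂μ, Summable fun i => f i x) : AEStronglyMeasurable (fun x => ∑' i, f i x) μ := by
  refine aestronglyMeasurable_of_tendsto_ae (Filter.atTop : Filter (Finset ι))
    (f := fun s x => ∑ i ∈ s, f i x) (fun s => ?_) ?_
  · exact Finset.aestronglyMeasurable_fun_sum s fun i _ => hf i
  · filter_upwards [h] with x hx using hx.hasSum

theorem lintegral_tsum_enorm_le (hf : ∀ i, AEStronglyMeasurable (f i) μ) :
    ∫⁻ x, ‖∑' i, f i x‖ₑ ∂μ ≤ ∑' i, ∫⁻ x, ‖f i x‖ₑ ∂μ := by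
  rw [← lintegral_tsum fun i => (hf i).enorm]
  exact lintegral_mono fun x => enorm_tsum_le_tsum_enorm

theorem integrable_tsum (hf : ∀ i, AEStronglyMeasurable (f i) μ)
    (h : ∑' i, ∫⁻ x, ‖f i x‖ₑ ∂μ < ∞) : Integrable (fun x => ∑' i, f i x) μ := by
  refine ⟨aestronglyMeasurable_tsum hf ?_, (lintegral_tsum_enorm_le hf).trans_lt h⟩
  have h1 : ∫⁻ x, ∑' i, ‖f i x‖ₑ ∂μ ≠ ∞ := by
    rw [lintegral_tsum fun i => (hf i).enorm]
    exact h.ne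
  filter_upwards [ae_lt_top' (AEMeasurable.tsum fun i => (hf i).enorm) h1] with x hx
  exact summable_of_tsum_enorm_ne_top hx.ne

theorem hasSum_integral (hf : ∀ i, AEStronglyMeasurable (f i) μ)
    (h : ∑' i, ∫⁻ x, ‖f i x‖ₑ ∂μ < ∞) :
    HasSum (fun i => ∫ x, f i x ∂μ) (∫ x, ∑' i, f i x ∂μ) := by
  rw [integral_tsum hf h.ne]
  refine (summable_of_tsum_enorm_ne_top (ne_top_of_le_ne_top h.ne ?_)).hasSum
  exact ENNReal.tsum_le_tsum fun i => enorm_integral_le_lintegral_enorm _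

end Series

open Classical in
/-- The `L²` function given by a dyadic block (zero if there is none). -/
def LittlewoodPaley.blockL2 (P : LittlewoodPaley n) (j : ℤ) (u : ZDual n) : L2 n :=
  if h : ∃ F : L2 n, (F : 𝓢'(E n, ℂ)) = P.block j u then h.choose else 0

theorem LittlewoodPaley.coe_blockL2 (P : LittlewoodPaley n) {j : ℤ} {u : ZDual n}
    (h : l2Norm (P.block j u) < ∞) : (P.blockL2 j u : 𝓢'(E n, ℂ)) = P.block j u := by
  have h' := exists_coe_eq_of_l2Norm_lt_top h
  rw [blockL2, dif_pos h']
  exact h'.choose_spec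

theorem LittlewoodPaley.enorm_blockL2 (P : LittlewoodPaley n) {j : ℤ} {u : ZDual n}
    (h : l2Norm (P.block j u) < ∞) : ‖P.blockL2 j u‖ₑ = l2Norm (P.block j u) := by
  rw [← P.coe_blockL2 h, l2Norm_coe]

theorem LittlewoodPaley.block_eq_integral (P : LittlewoodPaley n) {j : ℤ} {u : ZDual n}
    (h : l2Norm (P.block j u) < ∞) (ψ : 𝓢(E n, ℂ)) :
    P.block j u ψ = ∫ x, ψ x * P.blockL2 j u x := by
  rw [← P.coe_blockL2 h, Lp.toTemperedDistribution_apply]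
  rfl

theorem LittlewoodPaley.bandLimited_blockL2 (P : LittlewoodPaley n) {j : ℤ} {u : ZDual n}
    (h : l2Norm (P.block j u) < ∞) : BandLimited j (P.blockL2 j u) :=
  P.bandLimited_of_coe_eq_block (P.coe_blockL2 h)

theorem lintegral_enorm_mul_le_one (ψ : 𝓢(E n, ℂ)) {G : E n → ℂ} {B : ℝ≥0∞}
    (h : ∀ᵐ x, ‖G x‖ₑ ≤ B) (hB : B ≠ ∞) :
    ∫⁻ x, ‖ψ x * G x‖ₑ ≤ ‖ψ.toLp 1 volume‖ₑ * B := by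
  have h1 : ‖ψ.toLp 1 volume‖ₑ = ∫⁻ x, ‖ψ x‖ₑ := by
    rw [Lp.enorm_def, eLpNorm_congr_ae (ψ.coeFn_toLp 1 volume), eLpNorm_one_eq_lintegral_enorm]
  rw [h1, ← lintegral_mul_const' _ _ hB]
  refine lintegral_mono_ae ?_
  filter_upwards [h] with x hx
  rw [enorm_mul]
  gcongr

theorem lintegral_enorm_mul_le_two (ψ : 𝓢(E n, ℂ)) (F : L2 n) :
    ∫⁻ x, ‖ψ x * F x‖ₑ ≤ ‖ψ.toLp 2 volume‖ₑ * ‖F‖ₑ := by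
  refine le_trans (le_of_eq ?_) (lintegral_enorm_mul_enorm_le (ψ.toLp 2 volume) F)
  refine lintegral_congr_ae ?_
  filter_upwards [ψ.coeFn_toLp 2 volume] with x hx
  rw [hx, enorm_mul]

theorem BandLimited.ae_enorm_le {j : ℤ} {F : L2 n} (h : BandLimited j F) :
    ∀ᵐ x, ‖F x‖ₑ ≤ ENNReal.ofReal (bernsteinConst n * (2 : ℝ) ^ ((j : ℝ) * (n / 2))) * ‖F‖ₑ := by
  filter_upwards [h.ae_norm_le] with x hx
  rw [← ofReal_norm, ← ofReal_norm,
    ← ENNReal.ofReal_mul (mul_nonneg bernsteinConst_nonneg (by positivity))]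
  exact ENNReal.ofReal_le_ofReal hx

/-- The continuous norm `c₁ ‖ψ‖₁ + c₂ ‖ψ‖₂` on Schwartz functions, against which functions of
`𝓑^{n/2, n/2-1}` are integrable. -/
def testNorm (R₀ : ℝ) (ψ : 𝓢(E n, ℂ)) : ℝ :=
  bernsteinConst n * ‖ψ.toLp 1 volume‖ + R₀ ^ (-((n : ℝ) / 2 - 1)) * ‖ψ.toLp 2 volume‖

theorem continuous_testNorm (R₀ : ℝ) : Continuous (testNorm R₀ : 𝓢(E n, ℂ) → ℝ) := by
  unfold testNorm
  fun_prop

theorem testNorm_zero (R₀ : ℝ) : testNorm R₀ (0 : 𝓢(E n, ℂ)) = 0 := by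
  have h (p : ℝ≥0∞) [Fact (1 ≤ p)] : (0 : 𝓢(E n, ℂ)).toLp p volume = 0 :=
    (SchwartzMap.toLpCLM ℂ ℂ p volume).map_zero
  simp [testNorm, h]

theorem BandLimited.lintegral_mul_le {i : ℤ} {F : L2 n} (h : BandLimited i F) (hn : 2 ≤ n) {R₀ : ℝ}
    (hR₀ : 0 < R₀) (ψ : 𝓢(E n, ℂ)) :
    ∫⁻ x, ‖ψ x * F x‖ₑ ≤ ENNReal.ofReal (testNorm R₀ ψ) *
      (hybridWeight R₀ ((n : ℝ) / 2) ((n : ℝ) / 2 - 1) i * ‖F‖ₑ) := by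
  have hb := bernsteinConst_nonneg (n := n)
  have hr : (0 : ℝ) ≤ R₀ ^ (-((n : ℝ) / 2 - 1)) := by positivity
  rw [hybridWeight_eq, ← mul_assoc, ← ENNReal.ofReal_mul (by unfold testNorm; positivity)]
  by_cases hi : (2 : ℝ) ^ i ≤ R₀
  · refine (lintegral_enorm_mul_le_one ψ h.ae_enorm_le (by finiteness)).trans ?_
    rw [← mul_assoc, ← ofReal_norm (ψ.toLp 1 volume), ← ENNReal.ofReal_mul (norm_nonneg _)]
    refine mul_le_mul_left (ENNReal.ofReal_le_ofReal ?_) _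
    unfold testNorm
    rw [realWeight, if_pos hi, add_mul]
    have : 0 ≤ R₀ ^ (-((n : ℝ) / 2 - 1)) * ‖ψ.toLp 2 volume‖ * 2 ^ ((i : ℝ) * (n / 2)) := by
      positivity
    linarith
  · refine (lintegral_enorm_mul_le_two ψ F).trans ?_
    rw [← ofReal_norm (ψ.toLp 2 volume)]
    gcongr
    unfold testNorm
    rw [realWeight, if_neg hi]
    rw [not_le] at hi
    have hd : (0 : ℝ) ≤ (n : ℝ) / 2 - 1 := by
      rw [sub_nonneg, le_div_iff₀ (by norm_num)]
      exact_mod_cast (by omega : 1 * 2 ≤ n)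
    have h1 : R₀ ^ ((n : ℝ) / 2 - 1) ≤ (2 : ℝ) ^ ((i : ℝ) * ((n : ℝ) / 2 - 1)) := by
      rw [Real.rpow_mul (by norm_num), Real.rpow_intCast]
      exact Real.rpow_le_rpow hR₀.le hi.le hd
    have h2 : (1 : ℝ) ≤ R₀ ^ (-((n : ℝ) / 2 - 1)) * (2 : ℝ) ^ ((i : ℝ) * ((n : ℝ) / 2 - 1)) := by
      calc (1 : ℝ) = R₀ ^ (-((n : ℝ) / 2 - 1)) * R₀ ^ ((n : ℝ) / 2 - 1) := by
            rw [← Real.rpow_add hR₀]; simp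
        _ ≤ _ := mul_le_mul_of_nonneg_left h1 hr
    have h3 : 0 ≤ bernsteinConst n * ‖ψ.toLp 1 volume‖ * 2 ^ ((i : ℝ) * ((n : ℝ) / 2 - 1)) := by
      positivity
    nlinarith [mul_le_mul_of_nonneg_right h2 (norm_nonneg (ψ.toLp 2 volume))]

theorem BandLimited.ae_enorm_le_hybrid {j : ℤ} {G : L2 n} (h : BandLimited j G) {R₀ : ℝ} :
    ∀ᵐ x, ‖G x‖ₑ ≤ ENNReal.ofReal (bernsteinConst n * max 1 R₀) *
      (hybridWeight R₀ ((n : ℝ) / 2 - 1) ((n : ℝ) / 2) j * ‖G‖ₑ) := by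
  filter_upwards [h.ae_enorm_le] with x hx
  refine hx.trans ?_
  have hb := bernsteinConst_nonneg (n := n)
  rw [hybridWeight_eq, ← mul_assoc,
    ← ENNReal.ofReal_mul (mul_nonneg hb (le_max_of_le_left zero_le_one)), mul_assoc]
  gcongr
  unfold realWeight
  split_ifs with hj
  · have e : (2 : ℝ) ^ ((j : ℝ) * ((n : ℝ) / 2)) =
        (2 : ℝ) ^ j * (2 : ℝ) ^ ((j : ℝ) * ((n : ℝ) / 2 - 1)) := by
      rw [← Real.rpow_intCast, ← Real.rpow_add (by norm_num)]
      ring_nf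
    rw [e]
    gcongr
    exact le_max_of_le_right hj
  · exact le_mul_of_one_le_left (by positivity) (le_max_left _ _)

theorem l2Norm_block_lt_top {P : LittlewoodPaley n} {R₀ s σ : ℝ} {u : ZDual n}
    (h : hybridNorm P R₀ s σ u < ∞) (k : ℤ) : l2Norm (P.block k u) < ∞ := by
  have h1 := (ENNReal.le_tsum k).trans_lt h
  refine ENNReal.lt_top_of_mul_ne_top_right h1.ne ?_
  rw [hybridWeight_eq]
  simpa using realWeight_pos _ _ _ _

/-- The constant of the product estimate, before summation. -/
def productConst (P : LittlewoodPaley n) (R₀ : ℝ) : ℝ≥0∞ :=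
  ENNReal.ofReal (P.bound * bernsteinConst n * weightConst R₀ ((n : ℝ) / 2))

theorem exists_isProduct (P : LittlewoodPaley n) (hn : 2 ≤ n) {R₀ : ℝ} (hR₀ : 0 < R₀)
    {f g : ZDual n} (hf : hybridNorm P R₀ ((n : ℝ) / 2) ((n : ℝ) / 2 - 1) f < ∞)
    (hg : hybridNorm P R₀ ((n : ℝ) / 2 - 1) ((n : ℝ) / 2) g < ∞) :
    ∃ h : ZDual n, IsProduct P f g h ∧
      (∀ ψ : Z n, h ψ =
        ∑' i, ∑' j, ∫ x, (ψ : 𝓢(E n, ℂ)) x * (P.blockL2 i f x * P.blockL2 j g x)) ∧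
      ∀ k, dyadicWeight ((n : ℝ) / 2 - 1) k * l2Norm (P.block k h) ≤
        ∑' i, ∑' j, productConst P R₀ * decay (k - max i j) *
          ((hybridWeight R₀ ((n : ℝ) / 2) ((n : ℝ) / 2 - 1) i * l2Norm (P.block i f)) *
            (hybridWeight R₀ ((n : ℝ) / 2 - 1) ((n : ℝ) / 2) j * l2Norm (P.block j g))) := by
  have hft := l2Norm_block_lt_top hf
  have hgt := l2Norm_block_lt_top hg
  set F : ℤ → L2 n := fun i => P.blockL2 i f with hF
  set G : ℤ → L2 n := fun i => P.blockL2 i g with hG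
  have hFb (i : ℤ) : BandLimited i (F i) := P.bandLimited_blockL2 (hft i)
  have hGb (i : ℤ) : BandLimited i (G i) := P.bandLimited_blockL2 (hgt i)
  have hFn (i : ℤ) : ‖F i‖ₑ = l2Norm (P.block i f) := P.enorm_blockL2 (hft i)
  have hGn (i : ℤ) : ‖G i‖ₑ = l2Norm (P.block i g) := P.enorm_blockL2 (hgt i)
  have hFm (i : ℤ) : AEStronglyMeasurable (F i) := Lp.aestronglyMeasurable _
  have hGm (i : ℤ) : AEStronglyMeasurable (G i) := Lp.aestronglyMeasurable _
  have hψm (ψ : 𝓢(E n, ℂ)) : AEStronglyMeasurable ψ := ψ.continuous.aestronglyMeasurable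
  set Nf := hybridNorm P R₀ ((n : ℝ) / 2) ((n : ℝ) / 2 - 1) f with hNf
  -- bounds for the two series
  have hFsum (ψ : 𝓢(E n, ℂ)) :
      ∑' i, ∫⁻ x, ‖ψ x * F i x‖ₑ ≤ ENNReal.ofReal (testNorm R₀ ψ) * Nf := by
    rw [hNf, hybridNorm, ← ENNReal.tsum_mul_left]
    refine ENNReal.tsum_le_tsum fun i => ?_
    rw [← hFn]
    exact (hFb i).lintegral_mul_le hn hR₀ ψ
  have hFsum' (ψ : 𝓢(E n, ℂ)) : ∑' i, ∫⁻ x, ‖ψ x * F i x‖ₑ < ∞ :=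
    (hFsum ψ).trans_lt (ENNReal.mul_lt_top ENNReal.ofReal_lt_top hf)
  set γ : ℤ → ℝ≥0∞ := fun j => ENNReal.ofReal (bernsteinConst n * max 1 R₀) *
      (hybridWeight R₀ ((n : ℝ) / 2 - 1) ((n : ℝ) / 2) j * ‖G j‖ₑ) with hγ
  have hGx : ∀ᵐ x, ∀ j, ‖G j x‖ₑ ≤ γ j := by
    rw [ae_all_iff]
    exact fun j => (hGb j).ae_enorm_le_hybrid
  have hγsum : ∑' j, γ j < ∞ := by
    rw [hγ, ENNReal.tsum_mul_left]
    simp_rw [hGn]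
    exact ENNReal.mul_lt_top ENNReal.ofReal_lt_top hg
  set Γ := ∑' j, γ j with hΓ
  set F' : E n → ℂ := fun x => ∑' i, F i x with hF'
  set G' : E n → ℂ := fun x => ∑' j, G j x with hG'
  have hG'le : ∀ᵐ x, ‖G' x‖ₑ ≤ Γ := by
    filter_upwards [hGx] with x hx
    exact enorm_tsum_le_tsum_enorm.trans (ENNReal.tsum_le_tsum hx)
  have hG'm : AEStronglyMeasurable G' := by
    refine aestronglyMeasurable_tsum hGm ?_
    filter_upwards [hGx] with x hx
    exact summable_of_tsum_enorm_ne_top (ne_top_of_le_ne_top hγsum.ne (ENNReal.tsum_le_tsum hx))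
  have hFψ (ψ : 𝓢(E n, ℂ)) (i : ℤ) : AEStronglyMeasurable (fun x => ψ x * F i x) :=
    (hψm ψ).mul (hFm i)
  have hGψ (ψ : 𝓢(E n, ℂ)) (i : ℤ) : AEStronglyMeasurable (fun x => ψ x * G i x) :=
    (hψm ψ).mul (hGm i)
  have hrF : Represents P f F' := by
    intro ψ
    have e : (fun x => ψ x * F' x) = fun x => ∑' i, ψ x * F i x := by
      funext x
      exact tsum_mul_left.symm
    simp only [e, P.block_eq_integral (hft _)]
    exact ⟨integrable_tsum (hFψ ψ) (hFsum' ψ), hasSum_integral (hFψ ψ) (hFsum' ψ)⟩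
  have hrG : Represents P g G' := by
    intro ψ
    have e : (fun x => ψ x * G' x) = fun x => ∑' i, ψ x * G i x := by
      funext x
      exact tsum_mul_left.symm
    have hs : ∑' i, ∫⁻ x, ‖ψ x * G i x‖ₑ < ∞ := by
      refine lt_of_le_of_lt (ENNReal.tsum_le_tsum fun i => lintegral_enorm_mul_le_one ψ
        (hGx.mono fun x hx => hx i) (ne_top_of_le_ne_top hγsum.ne (ENNReal.le_tsum i))) ?_
      rw [ENNReal.tsum_mul_left]
      exact ENNReal.mul_lt_top enorm_lt_top hγsum
    simp only [e, P.block_eq_integral (hgt _)]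
    exact ⟨integrable_tsum (hGψ ψ) hs, hasSum_integral (hGψ ψ) hs⟩
  -- the product
  have hFGψ (ψ : 𝓢(E n, ℂ)) (i : ℤ) : AEStronglyMeasurable (fun x => ψ x * F i x * G' x) :=
    (hFψ ψ i).mul hG'm
  have hFGle (ψ : 𝓢(E n, ℂ)) (i : ℤ) :
      ∫⁻ x, ‖ψ x * F i x * G' x‖ₑ ≤ (∫⁻ x, ‖ψ x * F i x‖ₑ) * Γ := by
    rw [← lintegral_mul_const' _ _ hγsum.ne]
    refine lintegral_mono_ae ?_
    filter_upwards [hG'le] with x hx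
    rw [enorm_mul]
    gcongr
  have hFGsum (ψ : 𝓢(E n, ℂ)) : ∑' i, ∫⁻ x, ‖ψ x * F i x * G' x‖ₑ ≤
      ENNReal.ofReal (testNorm R₀ ψ) * Nf * Γ := by
    refine (ENNReal.tsum_le_tsum (hFGle ψ)).trans ?_
    rw [ENNReal.tsum_mul_right]
    gcongr
    exact hFsum ψ
  have hFGsum' (ψ : 𝓢(E n, ℂ)) : ∑' i, ∫⁻ x, ‖ψ x * F i x * G' x‖ₑ < ∞ :=
    (hFGsum ψ).trans_lt (ENNReal.mul_lt_top (ENNReal.mul_lt_top ENNReal.ofReal_lt_top hf) hγsum)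
  have hFGe (ψ : 𝓢(E n, ℂ)) :
      (fun x => ψ x * (F' x * G' x)) = fun x => ∑' i, ψ x * F i x * G' x := by
    funext x
    rw [tsum_mul_right, tsum_mul_left, mul_assoc]
  have hint (ψ : 𝓢(E n, ℂ)) : Integrable (fun x => ψ x * (F' x * G' x)) := by
    rw [hFGe]
    exact integrable_tsum (hFGψ ψ) (hFGsum' ψ)
  have hval (ψ : 𝓢(E n, ℂ)) : ∫ x, ψ x * (F' x * G' x) =
      ∑' i, ∑' j, ∫ x, ψ x * (F i x * G j x) := by
    rw [hFGe, ← (hasSum_integral (hFGψ ψ) (hFGsum' ψ)).tsum_eq]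
    refine tsum_congr fun i => ?_
    have hm (j : ℤ) : AEStronglyMeasurable (fun x => ψ x * (F i x * G j x)) :=
      (hψm ψ).mul ((hFm i).mul (hGm j))
    have hs : ∑' j, ∫⁻ x, ‖ψ x * (F i x * G j x)‖ₑ < ∞ := by
      have hle (j : ℤ) :
          ∫⁻ x, ‖ψ x * (F i x * G j x)‖ₑ ≤ (∫⁻ x, ‖ψ x * F i x‖ₑ) * γ j := by
        rw [← lintegral_mul_const' _ _ (ne_top_of_le_ne_top hγsum.ne (ENNReal.le_tsum j))]
        refine lintegral_mono_ae ?_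
        filter_upwards [hGx] with x hx
        rw [← mul_assoc, enorm_mul]
        gcongr
        exact hx j
      refine (ENNReal.tsum_le_tsum hle).trans_lt ?_
      rw [ENNReal.tsum_mul_left]
      exact ENNReal.mul_lt_top ((ENNReal.le_tsum i).trans_lt (hFsum' ψ)) hγsum
    rw [(hasSum_integral hm hs).tsum_eq]
    refine integral_congr_ae (.of_forall fun x => ?_)
    change ψ x * F i x * G' x = ∑' j, ψ x * (F i x * G j x)
    rw [tsum_mul_left, tsum_mul_left, mul_assoc]
  let T : 𝓢(E n, ℂ) →ₗ[ℂ] ℂ :=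
    { toFun := fun ψ => ∫ x, ψ x * (F' x * G' x)
      map_add' := fun ψ ψ' => by
        rw [← integral_add (hint ψ) (hint ψ')]
        refine integral_congr_ae (.of_forall fun x => ?_)
        simp [add_mul]
      map_smul' := fun c ψ => by
        rw [RingHom.id_apply, ← integral_smul]
        refine integral_congr_ae (.of_forall fun x => ?_)
        simp [mul_assoc] }
  have hTle (ψ : 𝓢(E n, ℂ)) : ‖T ψ‖ ≤ testNorm R₀ ψ * (Nf * Γ).toReal := by
    have h1 : ‖T ψ‖ₑ ≤ ENNReal.ofReal (testNorm R₀ ψ) * (Nf * Γ) := by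
      refine (enorm_integral_le_lintegral_enorm _).trans ?_
      have := (lintegral_tsum_enorm_le (hFGψ ψ)).trans (hFGsum ψ)
      rw [mul_assoc] at this
      refine le_trans (le_of_eq ?_) this
      exact lintegral_congr fun x => congrArg _ (congrFun (hFGe ψ) x)
    have hb := bernsteinConst_nonneg (n := n)
    have h0 : 0 ≤ testNorm R₀ ψ := by unfold testNorm; positivity
    rw [← ofReal_norm, ← ENNReal.ofReal_toReal (ENNReal.mul_lt_top hf hγsum).ne,
      ← ENNReal.ofReal_mul h0] at h1
    exact (ENNReal.ofReal_le_ofReal_iff (mul_nonneg h0 ENNReal.toReal_nonneg)).mp h1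
  have hTc : Continuous T := by
    refine continuous_of_continuousAt_zero T.toAddMonoidHom ?_
    have h0 : Filter.Tendsto (fun ψ : 𝓢(E n, ℂ) => testNorm R₀ ψ * (Nf * Γ).toReal)
        (nhds 0) (nhds 0) := by
      have := ((continuous_testNorm (n := n) R₀).mul_const (Nf * Γ).toReal).tendsto 0
      simpa [testNorm_zero] using this
    have := squeeze_zero_norm hTle h0
    rw [ContinuousAt]
    simpa using! this
  let h : ZDual n := (⟨T, hTc⟩ : 𝓢(E n, ℂ) →L[ℂ] ℂ) ∘L (Z n).subtypeL
  have hh (ψ : Z n) : h ψ = ∫ x, (ψ : 𝓢(E n, ℂ)) x * (F' x * G' x) := rfl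
  refine ⟨h, ⟨F', G', hrF, hrG, hint, hh⟩, fun ψ => (hh ψ).trans (hval ψ), fun k => ?_⟩
  classical
  set c : ℤ → ℤ → ℝ≥0∞ := fun i j =>
    ENNReal.ofReal (if Compatible k i j then P.bound * tripleFactor n k i j else 0) with hc
  have hk : l2Norm (P.block k h) ≤ ∑' i, ∑' j, c i j * (‖F i‖ₑ * ‖G j‖ₑ) := by
    refine l2Norm_le_of_bound fun ψ => ?_
    rw [P.block_apply, hh, hval, ← ENNReal.tsum_mul_right]
    refine enorm_tsum_le_tsum_enorm.trans (ENNReal.tsum_le_tsum fun i => ?_)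
    rw [← ENNReal.tsum_mul_right]
    refine enorm_tsum_le_tsum_enorm.trans (ENNReal.tsum_le_tsum fun j => ?_)
    exact P.enorm_integral_triple_le ψ (hFb i) (hGb j)
  refine (mul_le_mul_right hk _).trans ?_
  rw [← ENNReal.tsum_mul_left]
  refine ENNReal.tsum_le_tsum fun i => ?_
  rw [← ENNReal.tsum_mul_left]
  refine ENNReal.tsum_le_tsum fun j => ?_
  rw [← mul_assoc, ← hFn, ← hGn]
  refine (mul_le_mul_left (P.dyadicWeight_mul_le hn hR₀ k i j) _).trans_eq ?_
  rw [productConst]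
  ring

theorem exists_countable_forall_dist_lt {X Y : Type*} [PseudoMetricSpace Y]
    [SecondCountableTopology Y] (f : X → Y) :
    ∃ D : Set X, D.Countable ∧ ∀ x, ∀ ε > 0, ∃ d ∈ D, dist (f x) (f d) < ε := by
  let : PseudoMetricSpace X := PseudoMetricSpace.induced f inferInstance
  have : SecondCountableTopology X := TopologicalSpace.secondCountableTopology_induced X Y f
  obtain ⟨D, hD, hd⟩ := TopologicalSpace.exists_countable_dense X
  exact ⟨D, hD, fun x ε hε => hd.exists_dist_lt x hε⟩

instance finiteDimensional_continuousMultilinearMap (n l : ℕ) :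
    FiniteDimensional ℝ (ContinuousMultilinearMap ℝ (fun _ : Fin l => E n) ℂ) :=
  Module.Finite.of_injective
    (ContinuousMultilinearMap.toMultilinearMapLinear :
      ContinuousMultilinearMap ℝ (fun _ : Fin l => E n) ℂ →ₗ[ℝ] _)
    ContinuousMultilinearMap.toMultilinearMap_injective

theorem secondCountableTopology_of_seminorm {V : Type*} [AddCommGroup V] [Module ℂ V]
    (p : Seminorm ℂ V)
    (h : ∃ D : Set V, D.Countable ∧ ∀ v, ∀ ε > 0, ∃ d ∈ D, p (v - d) < ε) :
    @SecondCountableTopology V p.toSeminormedAddCommGroup.toUniformSpace.toTopologicalSpace := by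
  let := p.toSeminormedAddCommGroup
  obtain ⟨D, hD, hd⟩ := h
  have : TopologicalSpace.SeparableSpace V := by
    refine ⟨D, hD, Metric.dense_iff.mpr fun v ε hε => ?_⟩
    obtain ⟨d, hdD, hlt⟩ := hd v ε hε
    refine ⟨d, ?_, hdD⟩
    rw [Metric.mem_ball', dist_eq_norm]
    exact hlt
  exact UniformSpace.secondCountable_of_separable V

theorem exists_countable_forall_seminorm_lt (k l : ℕ) :
    ∃ D : Set 𝓢(E n, ℂ), D.Countable ∧
      ∀ ψ, ∀ ε > 0, ∃ d ∈ D, SchwartzMap.seminorm ℂ k l (ψ - d) < ε := by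
  let V := ContinuousMultilinearMap ℝ (fun _ : Fin l => E n) ℂ
  have : ProperSpace V := FiniteDimensional.proper ℝ V
  let B (N : ℕ) : Set (E n) := Metric.closedBall 0 N
  have (N : ℕ) : CompactSpace (B N) := isCompact_iff_compactSpace.mp (isCompact_closedBall _ _)
  let S (N m : ℕ) : Set 𝓢(E n, ℂ) :=
    {ψ | ∀ x, (N : ℝ) ≤ ‖x‖ → ‖x‖ ^ k * ‖iteratedFDeriv ℝ l ψ x‖ ≤ 1 / ((m : ℝ) + 1)}
  let Φ (N m : ℕ) (ψ : S N m) : C(B N, V) :=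
    ⟨fun x => iteratedFDeriv ℝ l (ψ : 𝓢(E n, ℂ)) x,
      ((ψ.1.smooth l).continuous_iteratedFDeriv le_rfl).comp continuous_subtype_val⟩
  choose D hD hd using fun N m => exists_countable_forall_dist_lt (Φ N m)
  refine ⟨⋃ N, ⋃ m, Subtype.val '' D N m,
    Set.countable_iUnion fun N => Set.countable_iUnion fun m => (hD N m).image _,
    fun ψ ε hε => ?_⟩
  obtain ⟨m, hm⟩ := exists_nat_one_div_lt (show 0 < ε / 4 by positivity)
  obtain ⟨C, hC0, hC⟩ := ψ.decay (k + 1) l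
  obtain ⟨N, hN⟩ := exists_nat_ge (max 1 (C * (m + 1)))
  have hN1 : (1 : ℝ) ≤ N := (le_max_left _ _).trans hN
  have hψ : ψ ∈ S N m := by
    intro x hx
    have hx0 : 0 < ‖x‖ := by linarith
    have h1 := hC x
    have h2 : C ≤ ‖x‖ * (1 / ((m : ℝ) + 1)) := by
      rw [mul_one_div, le_div_iff₀ (by positivity)]
      exact (le_max_right _ _).trans (hN.trans hx)
    rw [pow_succ'] at h1
    refine le_of_mul_le_mul_left ?_ hx0
    linarith
  obtain ⟨d, hdD, hdd⟩ := hd N m ⟨ψ, hψ⟩ (ε / 2 / (N : ℝ) ^ k) (by positivity)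
  refine ⟨d, Set.mem_iUnion₂.mpr ⟨N, m, ⟨d, hdD, rfl⟩⟩, ?_⟩
  refine lt_of_le_of_lt (SchwartzMap.seminorm_le_bound ℂ k l _ (M := ε / 2) (by positivity)
    fun x => ?_) (by linarith)
  have hsub : iteratedFDeriv ℝ l (ψ - (d : 𝓢(E n, ℂ)) : 𝓢(E n, ℂ)) x =
      iteratedFDeriv ℝ l ψ x - iteratedFDeriv ℝ l (d : 𝓢(E n, ℂ)) x := by
    have e : ⇑(ψ - (d : 𝓢(E n, ℂ)) : 𝓢(E n, ℂ)) = ⇑ψ - ⇑(d : 𝓢(E n, ℂ)) := rfl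
    rw [e, iteratedFDeriv_sub_apply (ψ.smooth l).contDiffAt (d.1.smooth l).contDiffAt]
  rw [hsub]
  rcases le_total (N : ℝ) ‖x‖ with hx | hx
  · calc _ ≤ ‖x‖ ^ k * (‖iteratedFDeriv ℝ l ψ x‖ + ‖iteratedFDeriv ℝ l (d : 𝓢(E n, ℂ)) x‖) := by
          gcongr
          exact norm_sub_le _ _
      _ ≤ 1 / ((m : ℝ) + 1) + 1 / ((m : ℝ) + 1) := by
          rw [mul_add]
          exact add_le_add (hψ x hx) (d.2 x hx)
      _ ≤ ε / 2 := by linarith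
  · have hxB : x ∈ B N := mem_closedBall_zero_iff.mpr hx
    have h1 := (ContinuousMap.dist_apply_le_dist (f := Φ N m ⟨ψ, hψ⟩) (g := Φ N m d)
      ⟨x, hxB⟩).trans hdd.le
    rw [dist_eq_norm] at h1
    calc _ ≤ (N : ℝ) ^ k * (ε / 2 / (N : ℝ) ^ k) := by
          gcongr
          exact h1
      _ = ε / 2 := by field_simp

instance secondCountableTopology_schwartz : SecondCountableTopology 𝓢(E n, ℂ) := by
  have h := (SeminormFamily.withSeminorms_iff_topologicalSpace_eq_iInf _).mp
    (schwartz_withSeminorms ℂ (E n) ℂ)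
  rw [h]
  exact TopologicalSpace.secondCountableTopology_iInf fun i =>
    secondCountableTopology_of_seminorm _ (exists_countable_forall_seminorm_lt i.1 i.2)

theorem l2Norm_eq_iSup {D : Set 𝓢(E n, ℂ)} (hD : Dense D) (v : 𝓢'(E n, ℂ)) :
    l2Norm v = ⨆ d : D, ‖v d‖ₑ / ‖(d : 𝓢(E n, ℂ)).toLp 2 volume‖ₑ := by
  refine le_antisymm ?_ (iSup_le fun d => le_iInf₂ fun F hF => ?_)
  · generalize hc : ⨆ d : D, ‖v d‖ₑ / ‖(d : 𝓢(E n, ℂ)).toLp 2 volume‖ₑ = c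
    rcases eq_or_ne c ∞ with rfl | hct
    · exact le_top
    have hcl : IsClosed {ψ : 𝓢(E n, ℂ) | ‖v ψ‖ₑ ≤ c * ‖ψ.toLp 2 volume‖ₑ} := by
      refine isClosed_le (by fun_prop) ?_
      refine (ENNReal.continuous_const_mul hct).comp ?_
      fun_prop
    have hsub : D ⊆ {ψ : 𝓢(E n, ℂ) | ‖v ψ‖ₑ ≤ c * ‖ψ.toLp 2 volume‖ₑ} := by
      intro d hd
      have := (le_iSup (fun d : D => ‖v d‖ₑ / ‖(d : 𝓢(E n, ℂ)).toLp 2 volume‖ₑ) ⟨d, hd⟩).trans_eq hc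
      rwa [ENNReal.div_le_iff_le_mul (.inr hct) (.inl enorm_ne_top)] at this
    refine l2Norm_le_of_bound fun ψ => ?_
    exact hcl.closure_subset_iff.mpr hsub (hD ψ)
  · rw [← hF]
    refine ENNReal.div_le_of_le_mul ?_
    rw [← ofReal_norm, ← ofReal_norm, ← ofReal_norm, ← ENNReal.ofReal_mul (norm_nonneg _)]
    exact ENNReal.ofReal_le_ofReal (norm_coe_apply_le F d)

theorem WeaklyMeasurable.aemeasurable_l2Norm {T : ℝ≥0∞} {u : ℝ → ZDual n}
    (hu : WeaklyMeasurable T u) (P : LittlewoodPaley n) (k : ℤ) :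
    AEMeasurable (fun t => l2Norm (P.block k (u t))) (timeMeasure T) := by
  obtain ⟨D, hD, hd⟩ := TopologicalSpace.exists_countable_dense 𝓢(E n, ℂ)
  have := hD.to_subtype
  simp_rw [l2Norm_eq_iSup hd, P.block_apply]
  exact AEMeasurable.iSup fun d => (hu _).enorm.div_const _

instance separableSpace_L2 : TopologicalSpace.SeparableSpace (L2 n) :=
  (SchwartzMap.denseRange_toLpCLM (p := 2) (F := ℂ) (E := E n) (μ := volume)
    ENNReal.ofNat_ne_top).separableSpace (SchwartzMap.toLpCLM ℝ ℂ 2 volume).continuous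

/-- The bilinear pairing `∫ F G` on `L²`. -/
def pairing (n : ℕ) : L2 n →L[ℂ] L2 n →L[ℂ] ℂ :=
  (ContinuousLinearMap.mul ℂ ℂ).lpPairing volume 2 2

theorem pairing_apply (F G : L2 n) : pairing n F G = ∫ x, F x * G x := by
  rw [pairing, ContinuousLinearMap.lpPairing_eq_integral]
  rfl

theorem inner_eq_pairing (F G : L2 n) : inner ℂ F G = pairing n (star F) G := by
  rw [pairing_apply, L2.inner_def]
  refine integral_congr_ae ?_
  filter_upwards [Lp.coeFn_star F] with x hx
  rw [hx, RCLike.inner_apply, mul_comm]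
  rfl

theorem countable_of_orthonormal {H : Type*} [NormedAddCommGroup H] [InnerProductSpace ℂ H]
    [TopologicalSpace.SeparableSpace H] {w : Set H} (hw : Orthonormal ℂ ((↑) : w → H)) :
    w.Countable := by
  have : SecondCountableTopology H := UniformSpace.secondCountable_of_separable H
  have : DiscreteTopology w := by
    refine DiscreteTopology.of_forall_le_dist (r := 1) one_pos fun x y hxy => ?_
    have h1 : ‖(x : H) - y‖ ^ 2 = 2 := by
      rw [@norm_sub_sq ℂ, hw.1 x, hw.1 y, hw.2 hxy]
      norm_num
    change 1 ≤ dist (x : H) y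
    rw [dist_eq_norm]
    nlinarith [norm_nonneg ((x : H) - y)]
  exact TopologicalSpace.separableSpace_iff_countable.mp inferInstance

/-- **Pettis' theorem** for `L²`, with Schwartz test functions. -/
theorem aestronglyMeasurable_of_forall_schwartz {μ : Measure ℝ} {F : ℝ → L2 n}
    (h : ∀ ψ : 𝓢(E n, ℂ), AEMeasurable (fun t => ∫ x, ψ x * F t x) μ) :
    AEStronglyMeasurable F μ := by
  have h1 (e : L2 n) : AEMeasurable (fun t => pairing n e (F t)) μ := by
    have hd : DenseRange (SchwartzMap.toLpCLM ℂ ℂ 2 (volume : Measure (E n))) :=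
      SchwartzMap.denseRange_toLpCLM (p := 2) ENNReal.ofNat_ne_top
    obtain ⟨x, hx, hlim⟩ := mem_closure_iff_seq_limit.mp (hd e)
    refine aemeasurable_of_tendsto_metrizable_ae (u := Filter.atTop)
      (f := fun m t => pairing n (x m) (F t)) (fun m => ?_) (.of_forall fun t => ?_)
    · obtain ⟨ψ, hψ⟩ := hx m
      rw [← hψ]
      refine (h ψ).congr (.of_forall fun t => ?_)
      simp only [pairing_apply]
      refine integral_congr_ae ?_
      filter_upwards [ψ.coeFn_toLp 2 volume] with y hy
      rw [SchwartzMap.toLpCLM_apply, hy]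
    · exact (((pairing n).flip (F t)).continuous.tendsto e).comp hlim
  obtain ⟨w, b, hb⟩ := exists_hilbertBasis ℂ (L2 n)
  have hw : w.Countable := countable_of_orthonormal (hb ▸ b.orthonormal)
  have := hw.to_subtype
  refine aestronglyMeasurable_of_tendsto_ae (Filter.atTop : Filter (Finset w))
    (f := fun s t => ∑ i ∈ s, b.repr (F t) i • b i) (fun s => ?_)
    (.of_forall fun t => b.hasSum_repr (F t))
  refine Finset.aestronglyMeasurable_fun_sum s fun i _ => ?_
  refine AEStronglyMeasurable.smul_const ?_ _
  simp_rw [b.repr_apply_apply, inner_eq_pairing]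
  exact (h1 _).aestronglyMeasurable

theorem aemeasurable_integral_mul_mul {μ : Measure ℝ} {F G : ℝ → L2 n}
    (hF : AEStronglyMeasurable F μ) (hG : AEStronglyMeasurable G μ) (ψ : 𝓢(E n, ℂ)) :
    AEMeasurable (fun t => ∫ x, ψ x * (F t x * G t x)) μ := by
  let M : L2 n →L[ℂ] L2 n := (ContinuousLinearMap.mul ℂ ℂ).holderL volume ∞ 2 2 (ψ.toLp ∞ volume)
  have hM (F : L2 n) : M F =ᵐ[volume] fun x => ψ x * F x := by
    have h1 := (ContinuousLinearMap.mul ℂ ℂ).coeFn_holder (r := 2) (ψ.toLp ∞ volume) F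
    filter_upwards [h1, ψ.coeFn_toLp ∞ volume] with x hx hx'
    rw [hx'] at hx
    exact hx
  have h2 := (pairing n).aestronglyMeasurable_comp₂ (M.continuous.comp_aestronglyMeasurable hF) hG
  refine h2.aemeasurable.congr (.of_forall fun t => ?_)
  simp only [pairing_apply]
  refine integral_congr_ae ?_
  filter_upwards [hM (F t)] with x hx
  rw [hx, mul_assoc]

section Lebesgue

variable {α : Type*} [MeasurableSpace α] {μ : Measure α} {p : ℝ≥0∞}

theorem ae_lt_top_of_eLpNorm_lt_top {a : α → ℝ≥0∞} (ha : AEMeasurable a μ) (hp : 1 ≤ p)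
    (h : eLpNorm a p μ < ∞) : ∀ᵐ t ∂μ, a t < ∞ := by
  have hp0 : p ≠ 0 := (zero_lt_one.trans_le hp).ne'
  rcases eq_or_ne p ∞ with rfl | hpt
  · rw [eLpNorm_exponent_top] at h
    filter_upwards [enorm_ae_le_eLpNormEssSup a μ] with t ht
    exact ht.trans_lt h
  · rw [eLpNorm_lt_top_iff_lintegral_rpow_enorm_lt_top hp0 hpt] at h
    have hp' : 0 < p.toReal := ENNReal.toReal_pos hp0 hpt
    filter_upwards [ae_lt_top' (ha.enorm.pow_const _) h.ne] with t ht
    exact (ENNReal.rpow_lt_top_iff_of_pos hp').mp ht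

/-- **Minkowski's inequality** for series. -/
theorem eLpNorm_tsum_le {ι : Type*} [Countable ι] {a : ι → α → ℝ≥0∞}
    (ha : ∀ i, AEMeasurable (a i) μ) (hp : 1 ≤ p) :
    eLpNorm (fun t => ∑' i, a i t) p μ ≤ ∑' i, eLpNorm (a i) p μ := by
  have hp0 : p ≠ 0 := (zero_lt_one.trans_le hp).ne'
  rcases eq_or_ne p ∞ with rfl | hpt
  · simp only [eLpNorm_exponent_top]
    refine eLpNormEssSup_le_of_ae_enorm_bound ?_
    filter_upwards [ae_all_iff.mpr fun i => enorm_ae_le_eLpNormEssSup (a i) μ] with t ht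
    exact ENNReal.tsum_le_tsum ht
  have hp' : 0 < p.toReal := ENNReal.toReal_pos hp0 hpt
  have hmono (t : α) : Monotone fun s : Finset ι => (∑ i ∈ s, a i t) ^ p.toReal :=
    fun s s' hs => ENNReal.rpow_le_rpow (Finset.sum_le_sum_of_subset hs) hp'.le
  have h1 : ∫⁻ t, ‖∑' i, a i t‖ₑ ^ p.toReal ∂μ =
      ⨆ s : Finset ι, ∫⁻ t, (∑ i ∈ s, a i t) ^ p.toReal ∂μ := by
    rw [← lintegral_iSup_directed
      (fun s => (Finset.aemeasurable_fun_sum s fun i _ => ha i).pow_const _)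
      (Monotone.directed_le fun s s' hs t => hmono t hs)]
    refine lintegral_congr fun t => ?_
    rw [enorm_eq_self, ENNReal.tsum_eq_iSup_sum]
    exact (ENNReal.orderIsoRpow p.toReal hp').map_iSup _
  rw [eLpNorm_eq_lintegral_rpow_enorm_toReal hp0 hpt, one_div,
    ENNReal.rpow_inv_le_iff hp', h1]
  refine iSup_le fun s => ?_
  have h2 := eLpNorm_sum_le (p := p) (s := s) (fun i _ => (ha i).aestronglyMeasurable) hp
  rw [eLpNorm_eq_lintegral_rpow_enorm_toReal hp0 hpt, one_div, ENNReal.rpow_inv_le_iff hp'] at h2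
  simp only [Finset.sum_apply, enorm_eq_self] at h2
  refine h2.trans ?_
  gcongr
  exact ENNReal.sum_le_tsum s

theorem eLpNorm_const_mul_le {a : α → ℝ≥0∞} {c : ℝ≥0∞} (hc : c ≠ ∞) :
    eLpNorm (fun t => c * a t) p μ ≤ c * eLpNorm a p μ := by
  lift c to ℝ≥0 using hc
  exact eLpNorm_le_nnreal_smul_eLpNorm_of_ae_le_mul' (.of_forall fun t => by simp) p

/-- **Hölder's inequality** for nonnegative functions. -/
theorem eLpNorm_mul_le {q r : ℝ≥0∞} [hpqr : ENNReal.HolderTriple p q r] {a b : α → ℝ≥0∞}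
    (ha : AEMeasurable a μ) (hb : AEMeasurable b μ) (ha' : ∀ᵐ t ∂μ, a t < ∞)
    (hb' : ∀ᵐ t ∂μ, b t < ∞) :
    eLpNorm (fun t => a t * b t) r μ ≤ eLpNorm a p μ * eLpNorm b q μ := by
  have key {c : α → ℝ≥0∞} (hc : ∀ᵐ t ∂μ, c t < ∞) (s : ℝ≥0∞) :
      eLpNorm (fun t => (c t).toReal) s μ = eLpNorm c s μ := by
    refine eLpNorm_congr_enorm_ae ?_
    filter_upwards [hc] with t ht
    rw [enorm_eq_self, Real.enorm_of_nonneg ENNReal.toReal_nonneg, ENNReal.ofReal_toReal ht.ne]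
  have hab : ∀ᵐ t ∂μ, a t * b t < ∞ := by
    filter_upwards [ha', hb'] with t h1 h2 using ENNReal.mul_lt_top h1 h2
  have h := eLpNorm_smul_le_mul_eLpNorm (p := p) (q := q) (r := r)
    hb.ennreal_toReal.aestronglyMeasurable ha.ennreal_toReal.aestronglyMeasurable
  rw [key ha', key hb'] at h
  rw [← key hab r]
  refine le_trans (le_of_eq ?_) h
  congr 1
  funext t
  simp [ENNReal.toReal_mul]

end Lebesgue

theorem tsum_decay_mul (K : ℝ≥0∞) (A B : ℤ → ℝ≥0∞) :
    ∑' k : ℤ, ∑' i, ∑' j, K * decay (k - max i j) * (A i * B j) =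
      K * (∑' k, decay k) * (∑' i, A i) * ∑' j, B j := by
  rw [ENNReal.tsum_comm]
  calc _ = ∑' i, ∑' j, K * (∑' k, decay k) * (A i * B j) := by
        refine tsum_congr fun i => ?_
        rw [ENNReal.tsum_comm]
        refine tsum_congr fun j => ?_
        rw [ENNReal.tsum_mul_right, ENNReal.tsum_mul_left, tsum_decay_sub]
    _ = _ := by
        simp_rw [ENNReal.tsum_mul_left, ENNReal.tsum_mul_right]
        ring

/-- The constant of the product estimate. -/
def productConst' (P : LittlewoodPaley n) (R₀ : ℝ) : ℝ≥0∞ := productConst P R₀ * ∑' k, decay k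

theorem productConst'_lt_top (P : LittlewoodPaley n) (R₀ : ℝ) : productConst' P R₀ < ∞ :=
  ENNReal.mul_lt_top ENNReal.ofReal_lt_top tsum_decay_lt_top

theorem hybridWeight_ne_top (R₀ s σ : ℝ) (k : ℤ) : hybridWeight R₀ s σ k ≠ ∞ := by
  rw [hybridWeight_eq]
  exact ENNReal.ofReal_ne_top

theorem ae_hybridNorm_lt_top {P : LittlewoodPaley n} {T r : ℝ≥0∞} {R₀ s σ : ℝ}
    {u : ℝ → ZDual n} (hr : 1 ≤ r) (hu : WeaklyMeasurable T u)
    (h : cheminLernerHybridNorm P T r R₀ s σ u < ∞) :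
    ∀ᵐ t ∂timeMeasure T, hybridNorm P R₀ s σ (u t) < ∞ := by
  have hm (k : ℤ) : AEMeasurable (fun t => hybridWeight R₀ s σ k * l2Norm (P.block k (u t)))
      (timeMeasure T) := (hu.aemeasurable_l2Norm P k).const_mul _
  refine ae_lt_top_of_eLpNorm_lt_top (AEMeasurable.tsum hm) hr
    (((eLpNorm_tsum_le hm hr).trans (ENNReal.tsum_le_tsum fun k => ?_)).trans_lt h)
  exact eLpNorm_const_mul_le (hybridWeight_ne_top _ _ _ _)

theorem WeaklyMeasurable.aestronglyMeasurable_blockL2 {T : ℝ≥0∞} {u : ℝ → ZDual n}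
    (hu : WeaklyMeasurable T u) {P : LittlewoodPaley n} {k : ℤ}
    (h : ∀ᵐ t ∂timeMeasure T, l2Norm (P.block k (u t)) < ∞) :
    AEStronglyMeasurable (fun t => P.blockL2 k (u t)) (timeMeasure T) := by
  refine aestronglyMeasurable_of_forall_schwartz fun ψ => (hu (P.testBlock k ψ)).congr ?_
  filter_upwards [h] with t ht
  rw [← P.block_eq_integral ht, P.block_apply]

theorem exists_isProduct_time (P : LittlewoodPaley n) (hn : 2 ≤ n) {R₀ : ℝ} (hR₀ : 0 < R₀)
    {T r r₁ r₂ : ℝ≥0∞} {f g : ℝ → ZDual n} (hr : 1 ≤ r) (hr₁ : 1 ≤ r₁) (hr₂ : 1 ≤ r₂)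
    (hrr : r⁻¹ = r₁⁻¹ + r₂⁻¹) (hfm : WeaklyMeasurable T f) (hgm : WeaklyMeasurable T g)
    (hf : cheminLernerHybridNorm P T r₁ R₀ ((n : ℝ) / 2) ((n : ℝ) / 2 - 1) f < ∞)
    (hg : cheminLernerHybridNorm P T r₂ R₀ ((n : ℝ) / 2 - 1) ((n : ℝ) / 2) g < ∞) :
    ∃ h : ℝ → ZDual n, WeaklyMeasurable T h ∧
      (∀ᵐ t ∂timeMeasure T, IsProduct P (f t) (g t) (h t)) ∧
      cheminLernerBesovNorm P T r ((n : ℝ) / 2 - 1) h ≤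
        productConst' P R₀ *
          cheminLernerHybridNorm P T r₁ R₀ ((n : ℝ) / 2) ((n : ℝ) / 2 - 1) f *
          cheminLernerHybridNorm P T r₂ R₀ ((n : ℝ) / 2 - 1) ((n : ℝ) / 2) g := by
  classical
  have : ENNReal.HolderTriple r₁ r₂ r := ⟨hrr.symm⟩
  have hft := ae_hybridNorm_lt_top hr₁ hfm hf
  have hgt := ae_hybridNorm_lt_top hr₂ hgm hg
  have hfk (k : ℤ) : ∀ᵐ t ∂timeMeasure T, l2Norm (P.block k (f t)) < ∞ :=
    hft.mono fun t ht => l2Norm_block_lt_top ht k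
  have hgk (k : ℤ) : ∀ᵐ t ∂timeMeasure T, l2Norm (P.block k (g t)) < ∞ :=
    hgt.mono fun t ht => l2Norm_block_lt_top ht k
  let h : ℝ → ZDual n := fun t =>
    if H : hybridNorm P R₀ ((n : ℝ) / 2) ((n : ℝ) / 2 - 1) (f t) < ∞ ∧
      hybridNorm P R₀ ((n : ℝ) / 2 - 1) ((n : ℝ) / 2) (g t) < ∞
    then (exists_isProduct P hn hR₀ H.1 H.2).choose else 0
  have hh : ∀ᵐ t ∂timeMeasure T, IsProduct P (f t) (g t) (h t) ∧
      (∀ ψ : Z n, h t ψ = ∑' i, ∑' j,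
        ∫ x, (ψ : 𝓢(E n, ℂ)) x * (P.blockL2 i (f t) x * P.blockL2 j (g t) x)) ∧
      ∀ k, dyadicWeight ((n : ℝ) / 2 - 1) k * l2Norm (P.block k (h t)) ≤
        ∑' i, ∑' j, productConst P R₀ * decay (k - max i j) *
          ((hybridWeight R₀ ((n : ℝ) / 2) ((n : ℝ) / 2 - 1) i * l2Norm (P.block i (f t))) *
            (hybridWeight R₀ ((n : ℝ) / 2 - 1) ((n : ℝ) / 2) j * l2Norm (P.block j (g t)))) := by
    filter_upwards [hft, hgt] with t h1 h2
    have e : h t = (exists_isProduct P hn hR₀ h1 h2).choose := dif_pos ⟨h1, h2⟩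
    rw [e]
    exact (exists_isProduct P hn hR₀ h1 h2).choose_spec
  refine ⟨h, fun ψ => ?_, hh.mono fun t ht => ht.1, ?_⟩
  · have hm : AEMeasurable (fun t => ∑' i, ∑' j,
        ∫ x, (ψ : 𝓢(E n, ℂ)) x * (P.blockL2 i (f t) x * P.blockL2 j (g t) x)) (timeMeasure T) :=
      AEMeasurable.tsum fun i => AEMeasurable.tsum fun j => aemeasurable_integral_mul_mul
        (hfm.aestronglyMeasurable_blockL2 (hfk i)) (hgm.aestronglyMeasurable_blockL2 (hgk j)) _
    exact hm.congr (hh.mono fun t ht => (ht.2.1 ψ).symm)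
  · set a : ℤ → ℝ → ℝ≥0∞ := fun i t =>
      hybridWeight R₀ ((n : ℝ) / 2) ((n : ℝ) / 2 - 1) i * l2Norm (P.block i (f t)) with ha
    set b : ℤ → ℝ → ℝ≥0∞ := fun j t =>
      hybridWeight R₀ ((n : ℝ) / 2 - 1) ((n : ℝ) / 2) j * l2Norm (P.block j (g t)) with hb
    have ham (i : ℤ) : AEMeasurable (a i) (timeMeasure T) :=
      (hfm.aemeasurable_l2Norm P i).const_mul _
    have hbm (j : ℤ) : AEMeasurable (b j) (timeMeasure T) :=
      (hgm.aemeasurable_l2Norm P j).const_mul _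
    have hat (i : ℤ) : ∀ᵐ t ∂timeMeasure T, a i t < ∞ := (hfk i).mono fun t ht =>
      ENNReal.mul_lt_top (hybridWeight_ne_top _ _ _ _).lt_top ht
    have hbt (j : ℤ) : ∀ᵐ t ∂timeMeasure T, b j t < ∞ := (hgk j).mono fun t ht =>
      ENNReal.mul_lt_top (hybridWeight_ne_top _ _ _ _).lt_top ht
    have hK (k i j : ℤ) : productConst P R₀ * decay (k - max i j) ≠ ∞ :=
      (ENNReal.mul_lt_top ENNReal.ofReal_lt_top ENNReal.ofReal_lt_top).ne
    have habm (k i j : ℤ) : AEMeasurable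
        (fun t => productConst P R₀ * decay (k - max i j) * (a i t * b j t)) (timeMeasure T) :=
      ((ham i).mul (hbm j)).const_mul _
    have hterm (k i j : ℤ) :
        eLpNorm (fun t => productConst P R₀ * decay (k - max i j) * (a i t * b j t)) r
          (timeMeasure T) ≤ productConst P R₀ * decay (k - max i j) *
            (eLpNorm (a i) r₁ (timeMeasure T) * eLpNorm (b j) r₂ (timeMeasure T)) := by
      refine (eLpNorm_const_mul_le (hK k i j)).trans ?_
      gcongr
      exact eLpNorm_mul_le (ham i) (hbm j) (hat i) (hbt j)
    have hsum (k : ℤ) : dyadicWeight ((n : ℝ) / 2 - 1) k * timeBlockNorm P T r k h ≤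
        ∑' i, ∑' j, productConst P R₀ * decay (k - max i j) *
            (eLpNorm (a i) r₁ (timeMeasure T) * eLpNorm (b j) r₂ (timeMeasure T)) := by
      have hw0 : dyadicWeight ((n : ℝ) / 2 - 1) k ≠ 0 := by
        unfold dyadicWeight
        simp only [ne_eq, ENNReal.ofReal_eq_zero, not_le]
        positivity
      have hwt : dyadicWeight ((n : ℝ) / 2 - 1) k ≠ ∞ := ENNReal.ofReal_ne_top
      have h1 : timeBlockNorm P T r k h ≤ (dyadicWeight ((n : ℝ) / 2 - 1) k)⁻¹ *
          eLpNorm (fun t => ∑' i, ∑' j, productConst P R₀ * decay (k - max i j) *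
            (a i t * b j t)) r (timeMeasure T) := by
        refine le_trans (eLpNorm_mono_enorm_ae ?_)
          (eLpNorm_const_mul_le (ENNReal.inv_ne_top.mpr hw0))
        filter_upwards [hh] with t ht
        rw [enorm_eq_self, enorm_eq_self]
        calc l2Norm (P.block k (h t)) = (dyadicWeight ((n : ℝ) / 2 - 1) k)⁻¹ *
              (dyadicWeight ((n : ℝ) / 2 - 1) k * l2Norm (P.block k (h t))) := by
              rw [← mul_assoc, ENNReal.inv_mul_cancel hw0 hwt, one_mul]
          _ ≤ _ := by
              gcongr
              exact ht.2.2 k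
      calc _ ≤ dyadicWeight ((n : ℝ) / 2 - 1) k * ((dyadicWeight ((n : ℝ) / 2 - 1) k)⁻¹ *
            eLpNorm (fun t => ∑' i, ∑' j, productConst P R₀ * decay (k - max i j) *
            (a i t * b j t)) r (timeMeasure T)) := by gcongr
        _ = eLpNorm (fun t => ∑' i, ∑' j, productConst P R₀ * decay (k - max i j) *
            (a i t * b j t)) r (timeMeasure T) := by
            rw [← mul_assoc, ENNReal.mul_inv_cancel hw0 hwt, one_mul]
        _ ≤ _ := by
            refine (eLpNorm_tsum_le (fun i => AEMeasurable.tsum fun j => habm k i j) hr).trans ?_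
            refine ENNReal.tsum_le_tsum fun i => ?_
            refine (eLpNorm_tsum_le (fun j => habm k i j) hr).trans ?_
            exact ENNReal.tsum_le_tsum fun j => hterm k i j
    refine (ENNReal.tsum_le_tsum hsum).trans ?_
    rw [tsum_decay_mul, ← productConst']
    refine mul_le_mul' (mul_le_mul' le_rfl ?_) ?_
    · exact ENNReal.tsum_le_tsum fun i => eLpNorm_const_mul_le (hybridWeight_ne_top _ _ _ _)
    · exact ENNReal.tsum_le_tsum fun i => eLpNorm_const_mul_le (hybridWeight_ne_top _ _ _ _)

end HybridBesov

end

theorem proposition5p2 (n : ℕ) (hn : 2 ≤ n) (P : HybridBesov.LittlewoodPaley n)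
    (R₀ : ℝ) (hR₀ : 0 < R₀) :
    ∃ C : ℝ≥0,
      (∀ f g : HybridBesov.ZDual n,
        HybridBesov.hybridNorm P R₀ ((n : ℝ) / 2) ((n : ℝ) / 2 - 1) f < ∞ →
        HybridBesov.hybridNorm P R₀ ((n : ℝ) / 2 - 1) ((n : ℝ) / 2) g < ∞ →
        ∃ h : HybridBesov.ZDual n,
          HybridBesov.IsProduct P f g h ∧
          HybridBesov.besovNorm P ((n : ℝ) / 2 - 1) h ≤
            C * HybridBesov.hybridNorm P R₀ ((n : ℝ) / 2) ((n : ℝ) / 2 - 1) f *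
              HybridBesov.hybridNorm P R₀ ((n : ℝ) / 2 - 1) ((n : ℝ) / 2) g) ∧
      (∀ (T r r₁ r₂ : ℝ≥0∞) (f g : ℝ → HybridBesov.ZDual n),
        1 ≤ r → 1 ≤ r₁ → 1 ≤ r₂ → r⁻¹ = r₁⁻¹ + r₂⁻¹ →
        HybridBesov.WeaklyMeasurable T f → HybridBesov.WeaklyMeasurable T g →
        HybridBesov.cheminLernerHybridNorm P T r₁ R₀ ((n : ℝ) / 2) ((n : ℝ) / 2 - 1) f < ∞ →
        HybridBesov.cheminLernerHybridNorm P T r₂ R₀ ((n : ℝ) / 2 - 1) ((n : ℝ) / 2) g < ∞ →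
        ∃ h : ℝ → HybridBesov.ZDual n,
          HybridBesov.WeaklyMeasurable T h ∧
          (∀ᵐ t ∂HybridBesov.timeMeasure T, HybridBesov.IsProduct P (f t) (g t) (h t)) ∧
          HybridBesov.cheminLernerBesovNorm P T r ((n : ℝ) / 2 - 1) h ≤
            C * HybridBesov.cheminLernerHybridNorm P T r₁ R₀ ((n : ℝ) / 2) ((n : ℝ) / 2 - 1) f *
              HybridBesov.cheminLernerHybridNorm P T r₂ R₀ ((n : ℝ) / 2 - 1) ((n : ℝ) / 2) g) := by
  refine ⟨(HybridBesov.productConst' P R₀).toNNReal, fun f g hf hg => ?_, ?_⟩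
  · obtain ⟨h, hh, -, hle⟩ := HybridBesov.exists_isProduct P hn hR₀ hf hg
    refine ⟨h, hh, ?_⟩
    rw [ENNReal.coe_toNNReal (HybridBesov.productConst'_lt_top P R₀).ne]
    refine (ENNReal.tsum_le_tsum hle).trans_eq ?_
    rw [HybridBesov.tsum_decay_mul]
    rfl
  · intro T r r₁ r₂ f g hr hr₁ hr₂ hrr hfm hgm hf hg
    rw [ENNReal.coe_toNNReal (HybridBesov.productConst'_lt_top P R₀).ne]
    exact HybridBesov.exists_isProduct_time P hn hR₀ hr hr₁ hr₂ hrr hfm hgm hf hg
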